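/- **Conventions.** Let $G$ be a group. A *system* $\mathbf A=(A,\mu,\alpha)$ consists of a von Neumann algebra $A$ on a complex Hilbert space, a faithful normal (i.e. $\sigma$-weakly continuous) state $\mu$ on $A$, and a group homomorphism $\alpha:G\to\mathrm{Aut}(A)$, $g\mapsto\alpha_g$, into the $*$-automorphisms of $A$ with $\mu\circ\alpha_g=\mu$ for all $g\in G$. Let $(H_\mu,\pi_\mu,\Omega_\mu)$ be the GNS representation of $(A,\mu)$, and let $U_g$ be the unitary operator on $H_\mu$ with $U_g\pi_\mu(a)\Omega_\mu=\pi_\mu(\alpha_g(a))\Omega_\mu$ for $a\in A$. An *eigenvector* of $U$ is an $x\in H_\mu\setminus\{0\}$ such that, for some function $\chi:G\to\mathbb C$ (its *eigenvalue*), $U_gx=\chi(g)x$ for all $g\in G$. The set of all eigenvalues is $\sigma_{\mathbf A}$, and $H_0$ is the closed linear span of the eigenvectors. An *eigenoperator* of $\alpha$ is a $u\in A\setminus\{0\}$ such that, for some $\chi:G\to\mathbb C$, $\alpha_g(u)=\chi(g)u$ for all $g\in G$. A system $\mathbf F=(F,\lambda,\varphi)$ over the same group is a *subsystem* of $\mathbf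 A$, with *imbedding* $\zeta$, if $\zeta:F\to A$ is an injective unital $*$-homomorphism onto a von Neumann subalgebra of $A$ with $\mu\circ\zeta=\lambda$ and $\alpha_g\circ\zeta=\zeta\circ\varphi_g$ for all $g\in G$; it is an *isomorphism* of systems if moreover $\zeta(F)=A$. A system $\mathbf A$ is *compact* if $\{U_gx:g\in G\}$ is totally bounded for every $x\in H_\mu$. Let $A^K$ be the von Neumann subalgebra of $A$ generated by the eigenoperators of $\alpha$, and $\mathbf A^K=(A^K,\mu|_{A^K},\alpha|_{A^K})$. **Theorem.** Let $\mathbf A=(A,\mu,\alpha)$ be a system over an abelian group $G$. Set $$T=\{a\in\pi_\mu(A): a\Omega_\mu\in H_0\},\qquad \xi(a)=\langle\Omega_\mu,a\Omega_\mu\rangle,\qquad \tau_g(a)=U_gaU_g^*\qquad(a\in T,\ g\in G).$$ Then: 1. $\mathbf A^K$ is a system, and a subsystem of $\mathbf A$ by inclusion. $\mathbf T=(T,\xi,\tau)$ is a system (in particular $T$ is a von Neumann algebra on $H_\mu$), it is a subsystem of $\mathbf A$ with imbedding $\pi_\mu^{-1}|_T$, and $\pi_\mu^{-1}|_T:T\to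 A^K$ is an isomorphism of the systems $\mathbf T$ and $\mathbf A^K$. 2. $\mathbf A^K$ is the largest compact subsystem of $\mathbf A$: it is compact, and for every compact subsystem $\mathbf F=(F,\lambda,\varphi)$ of $\mathbf A$ with imbedding $\zeta$ one has $\zeta(F)\subset A^K$. 3. $\overline{T\Omega_\mu}=H_0$; the elements of $T$ leave $H_0$ invariant, $\Omega_\mu\in H_0$, and $(H_0,\ a\mapsto a|_{H_0},\ \Omega_\mu)$ is a cyclic representation of $(T,\xi)$. 4. $\sigma_{\mathbf T}=\sigma_{\mathbf A}$. -/

import Mathlib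

open scoped InnerProductSpace ComplexOrder

/-! ## Von Neumann algebras acting on a Hilbert space, as C⋆-algebras -/

namespace VonNeumannAlgebra

variable {K : Type*} [NormedAddCommGroup K] [InnerProductSpace ℂ K] [CompleteSpace K]

instance instSMulMemClass : SMulMemClass (VonNeumannAlgebra K) ℂ (K →L[ℂ] K) where
  smul_mem {S} c _ ha := S.toStarSubalgebra.smul_mem ha c

instance instIsClosedCoe (M : VonNeumannAlgebra K) : IsClosed (M : Set (K →L[ℂ] K)) := by
  rw [← M.centralizer_centralizer]
  exact Set.isClosed_centralizer _

/-- An element of `M` that is positive as an operator is `s⋆ s` with `s ∈ M`, so that the order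
inherited from the bounded operators is the C⋆-algebra order of `M`. -/
instance instStarOrderedRingCoe (M : VonNeumannAlgebra K) : StarOrderedRing M := by
  refine StarOrderedRing.of_nonneg_iff' (fun {x y} h z => ?_) (fun x => ⟨fun h => ?_, ?_⟩)
  · have h' : (x : K →L[ℂ] K) ≤ y := h
    change (z : K →L[ℂ] K) + x ≤ z + y
    gcongr
  · have h' : (0 : K →L[ℂ] K) ≤ x := h
    have hmem : CFC.sqrt (x : K →L[ℂ] K) ∈ M := by
      rw [← SetLike.mem_coe, ← M.centralizer_centralizer]
      intro b hb
      have hc : Commute (x : K →L[ℂ] K) b := hb x x.2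
      have := hc.cfcₙ_nnreal NNReal.sqrt
      exact this.symm
    refine ⟨⟨_, hmem⟩, Subtype.ext ?_⟩
    have hs : star (CFC.sqrt (x : K →L[ℂ] K)) = CFC.sqrt (x : K →L[ℂ] K) :=
      (CFC.sqrt_nonneg _).isSelfAdjoint
    change (x : K →L[ℂ] K) = star (CFC.sqrt (x : K →L[ℂ] K)) * CFC.sqrt (x : K →L[ℂ] K)
    rw [hs, CFC.sqrt_mul_sqrt_self _ h']
  · rintro ⟨s, rfl⟩
    exact star_mul_self_nonneg (s : K →L[ℂ] K)

/-- The elements of a von Neumann algebra, as a type carrying the C⋆-algebra structure and the order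
inherited from the bounded operators. -/
def Elem (M : VonNeumannAlgebra K) : Type _ := M

noncomputable instance instCStarAlgebraElem (M : VonNeumannAlgebra K) : CStarAlgebra M.Elem :=
  inferInstanceAs (CStarAlgebra M)

instance instPartialOrderElem (M : VonNeumannAlgebra K) : PartialOrder M.Elem :=
  inferInstanceAs (PartialOrder M)

instance instStarOrderedRingElem (M : VonNeumannAlgebra K) : StarOrderedRing M.Elem :=
  instStarOrderedRingCoe M

/-- An element of a von Neumann algebra, as a bounded operator. -/
noncomputable def incl (M : VonNeumannAlgebra K) : M.Elem →⋆ₐ[ℂ] (K →L[ℂ] K) where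
  toFun := Subtype.val
  map_one' := rfl
  map_mul' _ _ := rfl
  map_zero' := rfl
  map_add' _ _ := rfl
  commutes' _ := rfl
  map_star' _ := rfl

noncomputable instance instCoeOutElem (M : VonNeumannAlgebra K) : CoeOut M.Elem (K →L[ℂ] K) :=
  ⟨M.incl⟩

theorem incl_injective (M : VonNeumannAlgebra K) : Function.Injective M.incl :=
  Subtype.val_injective

theorem range_incl (M : VonNeumannAlgebra K) : Set.range M.incl = (M : Set (K →L[ℂ] K)) :=
  Subtype.range_coe

theorem incl_nonneg_iff (M : VonNeumannAlgebra K) (a : M.Elem) : 0 ≤ M.incl a ↔ 0 ≤ a :=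
  Iff.rfl

/-- The von Neumann algebra `(S ∪ S⋆)''` generated by a set `S` of bounded operators. -/
noncomputable def generatedBy (S : Set (K →L[ℂ] K)) : VonNeumannAlgebra K where
  toStarSubalgebra :=
    StarSubalgebra.centralizer ℂ (StarSubalgebra.centralizer ℂ S : Set (K →L[ℂ] K))
  centralizer_centralizer' := by
    change Set.centralizer (Set.centralizer
      ((StarSubalgebra.centralizer ℂ
        (StarSubalgebra.centralizer ℂ S : Set (K →L[ℂ] K)) : Set (K →L[ℂ] K)))) = _
    rw [StarSubalgebra.coe_centralizer, Set.centralizer_centralizer_centralizer]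
    rfl

end VonNeumannAlgebra

/-- The σ-weak (ultraweak) topology on the bounded operators of a Hilbert space: the initial
topology for the functionals `a ↦ ∑ₙ ⟪ξₙ, a ηₙ⟫`, where `∑ₙ ‖ξₙ‖² < ∞` and `∑ₙ ‖ηₙ‖² < ∞`. -/
@[reducible]
noncomputable def sigmaWeakTopology (K : Type*) [NormedAddCommGroup K] [InnerProductSpace ℂ K] :
    TopologicalSpace (K →L[ℂ] K) :=
  ⨅ p : {p : (ℕ → K) × (ℕ → K) //
      Summable (fun n => ‖p.1 n‖ ^ 2) ∧ Summable (fun n => ‖p.2 n‖ ^ 2)},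
    TopologicalSpace.induced (fun a : K →L[ℂ] K => ∑' n, ⟪p.1.1 n, a (p.1.2 n)⟫_ℂ) inferInstance

/-- A functional on a von Neumann algebra is normal: it is continuous for the σ-weak topology. -/
def IsNormalFunctional {K : Type*} [NormedAddCommGroup K] [InnerProductSpace ℂ K]
    [CompleteSpace K] (M : VonNeumannAlgebra K) (f : M.Elem → ℂ) : Prop :=
  @Continuous M.Elem ℂ (TopologicalSpace.induced M.incl (sigmaWeakTopology K)) inferInstance f

/-! ## W⋆-dynamical systems -/

/-- A W⋆-dynamical system `(A, μ, α)` over the group `G`, whose von Neumann algebra `A` acts on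
the Hilbert space `K`. -/
structure WStarSystem (G : Type*) [Group G] (K : Type*) [NormedAddCommGroup K]
    [InnerProductSpace ℂ K] [CompleteSpace K] where
  /-- the von Neumann algebra `A` -/
  alg : VonNeumannAlgebra K
  /-- the state `μ` -/
  state : alg.Elem →ₚ[ℂ] ℂ
  state_one : state 1 = 1
  faithful : ∀ a : alg.Elem, state (star a * a) = 0 → a = 0
  normal : IsNormalFunctional alg state
  /-- the dynamics `α` -/
  action : G →* (alg.Elem ≃⋆ₐ[ℂ] alg.Elem)
  invariant : ∀ (g : G) (a : alg.Elem), state (action g a) = state a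

namespace WStarSystem

variable {G : Type*} [Group G]
variable {K : Type*} [NormedAddCommGroup K] [InnerProductSpace ℂ K] [CompleteSpace K]
variable {L : Type*} [NormedAddCommGroup L] [InnerProductSpace ℂ L] [CompleteSpace L]

/-- The GNS Hilbert space `H_μ`. -/
abbrev H (A : WStarSystem G K) : Type _ := A.state.GNS

/-- The GNS representation `π_μ`. -/
noncomputable def rep (A : WStarSystem G K) : A.alg.Elem →⋆ₐ[ℂ] (A.H →L[ℂ] A.H) :=
  A.state.gnsStarAlgHom

/-- The cyclic vector `Ω_μ`. -/
noncomputable def cyclicVector (A : WStarSystem G K) : A.H :=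
  ((A.state.toPreGNS 1 : A.state.PreGNS) : A.H)

/-- The map `γ_μ(a) ↦ γ_μ(α_g(a))` on the dense subspace of `H_μ` (before completion). -/
noncomputable def preUnitary (A : WStarSystem G K) (g : G) :
    A.state.PreGNS →L[ℂ] A.state.PreGNS :=
  LinearMap.mkContinuous
    { toFun := fun x => A.state.toPreGNS (A.action g (A.state.ofPreGNS x))
      map_add' := fun x y => by simp only [map_add]
      map_smul' := fun c x => by simp only [map_smul, RingHom.id_apply] }
    1 (fun x => by
      rw [one_mul, PositiveLinearMap.preGNS_norm_def, PositiveLinearMap.preGNS_norm_def]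
      apply le_of_eq
      have h := A.invariant g (star (A.state.ofPreGNS x) * A.state.ofPreGNS x)
      rw [map_mul, map_star] at h
      change √(A.state (star (A.action g (A.state.ofPreGNS x)) *
        A.action g (A.state.ofPreGNS x))).re = _
      rw [h])

/-- The unitary `U_g` on `H_μ`, the continuous extension of `γ_μ(a) ↦ γ_μ(α_g(a))`. -/
noncomputable def unitary (A : WStarSystem G K) (g : G) : A.H →L[ℂ] A.H :=
  (A.preUnitary g).completion

/-- `x` is an eigenvector of `U` with eigenvalue `χ : G → ℂ`. -/
def IsEigenvector (A : WStarSystem G K) (χ : G → ℂ) (x : A.H) : Prop :=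
  x ≠ 0 ∧ ∀ g, A.unitary g x = χ g • x

/-- The set `σ_𝐀` of eigenvalues of `U`. -/
def eigenvalues (A : WStarSystem G K) : Set (G → ℂ) :=
  {χ | ∃ x : A.H, A.IsEigenvector χ x}

/-- `H₀`, the closed linear span of the eigenvectors of `U`. -/
noncomputable def H0 (A : WStarSystem G K) : Submodule ℂ A.H :=
  (Submodule.span ℂ {x : A.H | ∃ χ : G → ℂ, A.IsEigenvector χ x}).topologicalClosure

instance instCompleteSpaceH0 (A : WStarSystem G K) : CompleteSpace A.H0 :=
  inferInstanceAs (CompleteSpace (Submodule.topologicalClosure _))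

/-- The set `T` of all `a ∈ π_μ(A)` with `a Ω_μ ∈ H₀`. -/
def compactPart (A : WStarSystem G K) : Set (A.H →L[ℂ] A.H) :=
  {a | a ∈ Set.range A.rep ∧ a A.cyclicVector ∈ A.H0}

/-- The system is compact: every orbit of `U` is totally bounded. -/
def IsCompact (A : WStarSystem G K) : Prop :=
  ∀ x : A.H, TotallyBounded (Set.range fun g => A.unitary g x)

/-- The nonzero `u ∈ A` with `α_g(u) = χ(g) u` for some `χ : G → ℂ`. -/
def eigenoperators (A : WStarSystem G K) : Set (K →L[ℂ] K) :=
  {v | ∃ u : A.alg.Elem, (u : K →L[ℂ] K) = v ∧ u ≠ 0 ∧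
    ∃ χ : G → ℂ, ∀ g, A.action g u = χ g • u}

/-- `A^K`, the von Neumann algebra generated by the eigenoperators of `α`. -/
noncomputable def eigenAlgebra (A : WStarSystem G K) : VonNeumannAlgebra K :=
  VonNeumannAlgebra.generatedBy A.eigenoperators

/-- `ζ` imbeds the system `F` into the system `A` as a subsystem: it is an injective unital
⋆-homomorphism onto a von Neumann subalgebra, which respects the states and the dynamics. -/
structure IsImbedding (F : WStarSystem G L) (A : WStarSystem G K)
    (ζ : F.alg.Elem →⋆ₐ[ℂ] A.alg.Elem) : Prop where
  injective : Function.Injective ζ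
  range_eq : ∃ N : VonNeumannAlgebra K,
    (N : Set (K →L[ℂ] K)) = Set.range fun a => (ζ a : K →L[ℂ] K)
  state_eq : ∀ a, A.state (ζ a) = F.state a
  action_eq : ∀ (g : G) (a : F.alg.Elem), A.action g (ζ a) = ζ (F.action g a)

/-- `ζ` is an isomorphism of dynamical systems. -/
def IsIsomorphism (F : WStarSystem G L) (A : WStarSystem G K)
    (ζ : F.alg.Elem →⋆ₐ[ℂ] A.alg.Elem) : Prop :=
  IsImbedding F A ζ ∧ Function.Surjective ζ

/-- `(E, ρ, ω)` is a cyclic representation of the algebra of `A` with its state. -/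
def IsCyclicRepresentation (A : WStarSystem G K) {E : Type*} [NormedAddCommGroup E]
    [InnerProductSpace ℂ E] [CompleteSpace E] (ρ : A.alg.Elem →⋆ₐ[ℂ] (E →L[ℂ] E)) (ω : E) : Prop :=
  (∀ a, ⟪ω, ρ a ω⟫_ℂ = A.state a) ∧ Dense (Set.range fun a => ρ a ω)

end WStarSystem

/-!
# The compact part of a W⋆-dynamical system of an abelian group

Write `Ω` for the cyclic vector, `π` for the GNS representation and `a ↦ π(a) Ω` for the map `vec`
from the algebra `A` into the GNS space. Everything follows from one equivalence: an element `a` of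
`A` lies in the algebra `A^K` generated by the eigenoperators if and only if `π(a) Ω ∈ H₀`
(`WStarSystem.mem_eigenAlgebra_iff`). Thus `T = π(A^K)`.

One direction is soft. An eigenoperator maps eigenvectors to eigenvectors, so it commutes with the
projection onto `H₀`, and the elements of `A` with this property form a von Neumann algebra.

For the converse, the projection of `π(a) Ω` onto the eigenspace of a character `ψ` is, by the mean
ergodic theorem, a limit of averages of `ψ(g)⁻¹ U_g π(a) Ω = π(ψ(g)⁻¹ α_g(a)) Ω`. Balls of von
Neumann algebras are weakly compact and the state is normal, so that vectors `π(d) Ω` with `d` in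
such a ball form a closed set (`WStarSystem.isClosed_vec_ball`). Hence the projection is `π(b) Ω`
for some `b ∈ A`, and `b` is an eigenoperator because `Ω` is separating. Summing over characters
need not keep the norms of the operators bounded, and this is where Fejér-like kernels enter. The
discrete group of characters is abelian, hence has finite Følner sets `F`, and the kernels
`k(g) = |∑_{χ ∈ F} χ(g)|² / |F|` are positive of mean `1`. The averages of `k(g) α_g(a)` have norm
at most `2 ‖a‖`, they are finite combinations of eigenoperators, and they approximate the identity
on `H₀`. So if `π(a) Ω ∈ H₀`, then it is a limit of `π(d) Ω` with `d` in a ball of `A^K`, and again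
by closedness `a ∈ A^K`.

That `π` carries von Neumann subalgebras to von Neumann algebras, in both directions, follows from
weak compactness of balls together with Kaplansky's density theorem, in the form that elements of
the bicommutant are limits of bounded filters
(`exists_bounded_filter_of_mem_bicommutant`).

An imbedding of systems induces an isometry of the GNS spaces which intertwines the unitary
representations (`WStarSystem.IsImbedding.exists_isometry`), and this transports orbits and
eigenvectors. Vectors in `H₀` have totally bounded orbits. Conversely a vector with totally bounded
orbit lies in `H₀` (`mem_eigenvectorSpan_of_totallyBounded_orbit`): otherwise the rank one operators
along the orbit of its component orthogonal to `H₀` have a compact closed convex hull, in which the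
Markov–Kakutani theorem finds a nonzero compact operator commuting with the representation. Its
eigenspaces for nonzero eigenvalues are finite-dimensional and invariant, so that they contain
eigenvectors orthogonal to `H₀`, a contradiction. Therefore compact subsystems have their GNS
vectors in `H₀`, that is, they lie in `A^K`.
-/

open Filter Topology

/-! ### The bicommutant theorem and Kaplansky's density theorem -/

/-- A point of the closure of `f '' s` is the limit of `f` along a filter on `s`. -/
theorem exists_filter_tendsto_of_mem_closure_image {X Y : Type*} [TopologicalSpace Y] {f : X → Y}
    {s : Set X} {y : Y} (h : y ∈ closure (f '' s)) :
    ∃ l : Filter X, l.NeBot ∧ s ∈ l ∧ Tendsto f l (𝓝 y) := by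
  refine ⟨comap f (𝓝 y) ⊓ 𝓟 s, ?_, mem_inf_of_right (mem_principal_self s),
    tendsto_comap.mono_left inf_le_left⟩
  rw [mem_closure_iff_clusterPt, ClusterPt, ← map_principal, ← Filter.push_pull'] at h
  exact map_neBot_iff _ |>.1 h

section Kaplansky

variable {H : Type*} [NormedAddCommGroup H] [InnerProductSpace ℂ H]

/-- A map `t` is a limit, for the topology of pointwise convergence, of operators from `s`, as soon
as it can be approximated on finite families of vectors. -/
theorem mem_closure_image_coe_iff {s : Set (H →L[ℂ] H)} {t : H → H} :
    t ∈ closure ((fun a : H →L[ℂ] H => (a : H → H)) '' s) ↔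
      ∀ F : Finset H, ∀ ε > 0, ∃ a ∈ s, ∀ x ∈ F, ‖a x - t x‖ < ε := by
  constructor
  · intro h F ε hε
    obtain ⟨l, hl, hs, ht⟩ := exists_filter_tendsto_of_mem_closure_image h
    have : ∀ᶠ a in l, ∀ x ∈ F, ‖a x - t x‖ < ε := by
      rw [Filter.eventually_all_finset]
      intro x _
      have := (tendsto_pi_nhds.1 ht x).eventually (Metric.ball_mem_nhds _ hε)
      simpa [dist_eq_norm] using this
    obtain ⟨a, ha, ha'⟩ := ((show ∀ᶠ a in l, a ∈ s from hs).and this).exists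
    exact ⟨a, ha, ha'⟩
  · intro h
    rw [mem_closure_iff_nhds]
    intro V hV
    rw [nhds_pi, Filter.mem_pi] at hV
    obtain ⟨I, hI, W, hW, hsub⟩ := hV
    choose r hr hrW using fun x => Metric.mem_nhds_iff.1 (hW x)
    obtain ⟨ε, hε, hle⟩ : ∃ ε > 0, ∀ x ∈ hI.toFinset, ε ≤ r x := by
      classical
      induction hI.toFinset using Finset.induction_on with
      | empty => exact ⟨1, one_pos, by simp⟩
      | insert x F _ ih =>
        obtain ⟨ε, hε, h⟩ := ih
        refine ⟨min ε (r x), lt_min hε (hr x), ?_⟩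
        intro y hy
        rcases Finset.mem_insert.1 hy with rfl | hy
        · exact min_le_right _ _
        · exact (min_le_left _ _).trans (h y hy)
    obtain ⟨a, ha, hax⟩ := h hI.toFinset ε hε
    refine ⟨a, hsub ?_, a, ha, rfl⟩
    intro x hx
    refine hrW x ?_
    have hx' : x ∈ hI.toFinset := by simpa using hx
    rw [Metric.mem_ball, dist_eq_norm]
    exact (hax x hx').trans_le (hle x hx')

variable [CompleteSpace H]

/-- The bicommutant theorem for a finite family of vectors, proved by letting the algebra act
diagonally on a finite Hilbert sum of copies of `H`: the matrix entries of the projection onto the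
closure of the orbit of the family lie in the commutant. -/
theorem exists_mem_near_of_mem_bicommutant {ι : Type*} [Fintype ι]
    (S : StarSubalgebra ℂ (H →L[ℂ] H)) {t : H →L[ℂ] H}
    (ht : t ∈ Set.centralizer (Set.centralizer (S : Set (H →L[ℂ] H)))) (x : ι → H) {ε : ℝ}
    (hε : 0 < ε) : ∃ a ∈ S, ∀ i, ‖a (x i) - t (x i)‖ < ε := by
  classical
  let e := PiLp.continuousLinearEquiv 2 ℂ (fun _ : ι => H)
  let amp : (H →L[ℂ] H) → (PiLp 2 fun _ : ι => H) →L[ℂ] (PiLp 2 fun _ : ι => H) := fun a =>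
    e.symm.toContinuousLinearMap ∘L
      (ContinuousLinearMap.pi fun i => a ∘L ContinuousLinearMap.proj i) ∘L e.toContinuousLinearMap
  have amp_apply : ∀ a v i, amp a v i = a (v i) := fun a v i => rfl
  have amp_inner : ∀ a v w, ⟪amp a v, w⟫_ℂ = ⟪v, amp (star a) w⟫_ℂ := by
    intro a v w
    simp only [PiLp.inner_apply, amp_apply, ContinuousLinearMap.star_eq_adjoint,
      ContinuousLinearMap.adjoint_inner_right]
  let L : (H →L[ℂ] H) →ₗ[ℂ] (PiLp 2 fun _ : ι => H) :=
    { toFun := fun a => amp a (WithLp.toLp 2 x)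
      map_add' := fun a b => by ext i; simp [amp_apply]
      map_smul' := fun c a => by ext i; simp [amp_apply] }
  have amp_L : ∀ a b, amp a (L b) = L (a * b) := fun a b => rfl
  let V : Submodule ℂ (PiLp 2 fun _ : ι => H) :=
    (S.toSubalgebra.toSubmodule.map L).topologicalClosure
  have hVc : IsClosed (V : Set (PiLp 2 fun _ : ι => H)) := Submodule.isClosed_topologicalClosure _
  have : CompleteSpace V := hVc.completeSpace_coe
  have hV : ∀ a ∈ S, ∀ v ∈ V, amp a v ∈ V := by
    intro a ha v hv
    have hv' : v ∈ closure ((S.toSubalgebra.toSubmodule.map L : Submodule ℂ _) :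
        Set (PiLp 2 fun _ : ι => H)) := hv
    change amp a v ∈ closure _
    refine map_mem_closure (amp a).continuous hv' ?_
    rintro _ ⟨b, hb, rfl⟩
    exact ⟨a * b, S.mul_mem ha hb, (amp_L a b).symm⟩
  have hVo : ∀ a ∈ S, ∀ v ∈ Vᗮ, amp a v ∈ Vᗮ := by
    intro a ha v hv w hw
    rw [← star_star a, ← amp_inner]
    exact hv _ (hV _ (star_mem ha) _ hw)
  have hP : ∀ a ∈ S, ∀ v, V.starProjection (amp a v) = amp a (V.starProjection v) := by
    intro a ha v
    refine Submodule.eq_starProjection_of_mem_orthogonal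
      (hV a ha _ (V.starProjection_apply_mem v)) ?_
    rw [← map_sub]
    exact hVo a ha _ (V.sub_starProjection_mem_orthogonal v)
  let P : ι → ι → H →L[ℂ] H := fun i j =>
    ContinuousLinearMap.proj i ∘L e.toContinuousLinearMap ∘L V.starProjection ∘L
      e.symm.toContinuousLinearMap ∘L ContinuousLinearMap.single ℂ (fun _ : ι => H) j
  have P_apply : ∀ i j y, P i j y = V.starProjection (WithLp.toLp 2 (Pi.single j y)) i :=
    fun i j y => rfl
  have amp_single : ∀ a j y, amp a (WithLp.toLp 2 (Pi.single j y)) =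
      WithLp.toLp 2 (Pi.single j (a y)) := by
    intro a j y
    ext i
    rw [amp_apply]
    by_cases h : i = j
    · subst h; simp
    · simp [h]
  have hPc : ∀ i j, P i j ∈ Set.centralizer (S : Set (H →L[ℂ] H)) := by
    intro i j a ha
    ext y
    change a (P i j y) = P i j (a y)
    rw [P_apply, P_apply, ← amp_single, hP a ha, amp_apply]
  have hPt : ∀ v, V.starProjection (amp t v) = amp t (V.starProjection v) := by
    intro v
    have hv : v = ∑ j, WithLp.toLp 2 (Pi.single j (v j)) := by
      ext i
      simp [Finset.sum_apply, Pi.single_apply]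
    have key : ∀ j y, V.starProjection (amp t (WithLp.toLp 2 (Pi.single j y))) =
        amp t (V.starProjection (WithLp.toLp 2 (Pi.single j y))) := by
      intro j y
      ext i
      rw [amp_single, amp_apply, ← P_apply, ← P_apply]
      exact congrArg (fun b : H →L[ℂ] H => b y) (ht _ (hPc i j))
    rw [hv]
    simp only [map_sum, key]
  have hx : L 1 ∈ V := Submodule.le_topologicalClosure _ ⟨1, S.one_mem, rfl⟩
  have htx : L t ∈ V := by
    have h1 : L t = amp t (L 1) := by rw [amp_L, mul_one]
    rw [h1, ← Submodule.starProjection_eq_self_iff.2 hx, ← hPt]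
    exact V.starProjection_apply_mem _
  obtain ⟨_, ⟨a, ha, rfl⟩, hd⟩ := Metric.mem_closure_iff.1
    (show L t ∈ closure ((S.toSubalgebra.toSubmodule.map L : Submodule ℂ _) :
        Set (PiLp 2 fun _ : ι => H)) from htx) ε hε
  refine ⟨a, ha, fun i => ?_⟩
  have h2 := PiLp.norm_apply_le (L a - L t) i
  rw [dist_comm, dist_eq_norm] at hd
  exact h2.trans_lt hd

theorem mem_closure_coe_of_mem_bicommutant (S : StarSubalgebra ℂ (H →L[ℂ] H)) {t : H →L[ℂ] H}
    (ht : t ∈ Set.centralizer (Set.centralizer (S : Set (H →L[ℂ] H)))) :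
    (t : H → H) ∈ closure ((fun a : H →L[ℂ] H => (a : H → H)) '' S) := by
  rw [mem_closure_image_coe_iff]
  intro F ε hε
  obtain ⟨a, ha, h⟩ := exists_mem_near_of_mem_bicommutant S ht (fun x : F => (x : H)) hε
  exact ⟨a, ha, fun x hx => h ⟨x, hx⟩⟩

theorem isSelfAdjoint_real_smul (r : ℝ) {a : H →L[ℂ] H} (ha : IsSelfAdjoint a) :
    IsSelfAdjoint (r • a) :=
  (IsSelfAdjoint.all r).smul ha

theorem StarSubalgebra.real_smul_mem (S : StarSubalgebra ℂ (H →L[ℂ] H)) (r : ℝ) {a : H →L[ℂ] H}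
    (ha : a ∈ S) : r • a ∈ S := by
  have := S.smul_mem ha (r : ℂ)
  rwa [Complex.coe_smul] at this

/-- A self-adjoint element of the bicommutant is approximated by self-adjoint elements of the
algebra. Separation by a hyperplane reduces the claim to weak approximation, where taking
self-adjoint parts is continuous. -/
theorem mem_closure_coe_isSelfAdjoint (S : StarSubalgebra ℂ (H →L[ℂ] H)) {t : H →L[ℂ] H}
    (ht : t ∈ Set.centralizer (Set.centralizer (S : Set (H →L[ℂ] H)))) (hsa : IsSelfAdjoint t) :
    (t : H → H) ∈
      closure ((fun a : H →L[ℂ] H => (a : H → H)) '' {a | a ∈ S ∧ IsSelfAdjoint a}) := by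
  classical
  rw [mem_closure_image_coe_iff]
  intro F ε hε
  let C : Set (F → H) := {v | ∃ a ∈ S, IsSelfAdjoint a ∧ v = fun x : F => a x}
  have hC : (fun x : F => t x) ∈ closure C := by
    by_contra hn
    have hconv : Convex ℝ C := by
      rintro _ ⟨a, ha, ha', rfl⟩ _ ⟨b, hb, hb', rfl⟩ p q _ _ _
      refine ⟨p • a + q • b, add_mem ?_ ?_,
        (isSelfAdjoint_real_smul _ ha').add (isSelfAdjoint_real_smul _ hb'), rfl⟩
      · exact S.real_smul_mem _ ha
      · exact S.real_smul_mem _ hb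
    obtain ⟨f, u, hfu, hu⟩ := RCLike.geometric_hahn_banach_point_closed (𝕜 := ℂ) hconv.closure
      isClosed_closure hn
    have h0 : ∀ a ∈ S, IsSelfAdjoint a → RCLike.re (f fun x : F => a x) = 0 := by
      intro a ha ha'
      by_contra hne
      have hmem : (fun x : F => ((u / RCLike.re (f fun x : F => a x)) • a) x) ∈ C := by
        exact ⟨_, S.real_smul_mem _ ha, isSelfAdjoint_real_smul _ ha', rfl⟩
      have h1 := hu _ (subset_closure hmem)
      have h2 : (fun x : F => ((u / RCLike.re (f fun x : F => a x)) • a) x) =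
          ((u / RCLike.re (f fun x : F => a x) : ℝ) : ℂ) • fun x : F => a x := by
        ext x
        exact (Complex.coe_smul _ (a x)).symm
      rw [h2, map_smul, smul_eq_mul, RCLike.re_to_complex, Complex.re_ofReal_mul,
        ← RCLike.re_to_complex, div_mul_cancel₀ _ hne] at h1
      exact lt_irrefl _ h1
    have hu0 : u < 0 := by
      have := hu _ (subset_closure ⟨0, S.zero_mem, .zero _, rfl⟩)
      rwa [show (fun x : F => (0 : H →L[ℂ] H) x) = 0 from rfl, map_zero, map_zero] at this
    -- the functional `f` is given by a family of vectors `w`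
    let w : F → H := fun i => (InnerProductSpace.toDual ℂ H).symm
      (f ∘L ContinuousLinearMap.single ℂ (fun _ : F => H) i)
    have hw : ∀ v : F → H, f v = ∑ i, ⟪w i, v i⟫_ℂ := by
      intro v
      have hv : v = ∑ i, Pi.single i (v i) := (Finset.univ_sum_single v).symm
      conv_lhs => rw [hv]
      rw [map_sum]
      refine Finset.sum_congr rfl fun i _ => ?_
      simp only [w, InnerProductSpace.toDual_symm_apply]
      rfl
    -- twice the real part of `f` on the self-adjoint part of an operator
    let φ : (H → H) → ℝ := fun h =>
      ∑ i : F, (RCLike.re ⟪w i, h i⟫_ℂ + RCLike.re ⟪(i : H), h (w i)⟫_ℂ)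
    have hφ : Continuous φ := by
      refine continuous_finsetSum _ fun i _ => ?_
      exact (RCLike.continuous_re.comp (continuous_const.inner (continuous_apply _))).add
        (RCLike.continuous_re.comp (continuous_const.inner (continuous_apply _)))
    have hφ' : ∀ a : H →L[ℂ] H, φ a = RCLike.re (f fun x : F => (a + star a) x) := by
      intro a
      rw [hw, map_sum]
      refine Finset.sum_congr rfl fun i _ => ?_
      rw [_root_.add_apply, inner_add_right, map_add,
        ContinuousLinearMap.star_eq_adjoint, ContinuousLinearMap.adjoint_inner_right,
        inner_re_symm (i : H)]
    have hzero : φ t = 0 := by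
      have hcl : IsClosed {h : H → H | φ h = 0} := isClosed_eq hφ continuous_const
      refine closure_minimal ?_ hcl (mem_closure_coe_of_mem_bicommutant S ht)
      rintro _ ⟨a, ha, rfl⟩
      change φ a = 0
      rw [hφ']
      exact h0 _ (add_mem ha (star_mem ha)) (IsSelfAdjoint.add_star_self a)
    rw [hφ', hsa.star_eq] at hzero
    have h3 : (fun x : F => (t + t) x) = (fun x : F => t x) + fun x : F => t x := rfl
    rw [h3, map_add, map_add] at hzero
    linarith
  obtain ⟨_, ⟨a, ha, ha', rfl⟩, hd⟩ := Metric.mem_closure_iff.1 hC ε hε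
  refine ⟨a, ⟨ha, ha'⟩, fun x hx => ?_⟩
  rw [dist_comm, dist_pi_lt_iff hε] at hd
  simpa [dist_eq_norm] using hd ⟨x, hx⟩

/-- Kaplansky's function `x ↦ 2x / (1 + x²)` of an operator. -/
noncomputable def kaplanskyTransform (x : H →L[ℂ] H) : H →L[ℂ] H :=
  cfc (fun s : ℝ => 2 * s * (1 + s ^ 2)⁻¹) x

/-- The resolvent-like operator `(1 + x²)⁻¹`. -/
noncomputable def kaplanskyResolvent (x : H →L[ℂ] H) : H →L[ℂ] H :=
  cfc (fun s : ℝ => (1 + s ^ 2)⁻¹) x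

theorem continuous_one_add_sq_inv : Continuous fun s : ℝ => (1 + s ^ 2)⁻¹ :=
  Continuous.inv₀ (by fun_prop) fun s => by positivity

theorem norm_kaplanskyTransform_le (x : H →L[ℂ] H) : ‖kaplanskyTransform x‖ ≤ 1 := by
  refine norm_cfc_le zero_le_one fun s _ => ?_
  rw [Real.norm_eq_abs, ← div_eq_mul_inv, abs_div, abs_of_pos (by positivity : 0 < 1 + s ^ 2),
    div_le_one (by positivity), abs_le]
  constructor <;> nlinarith [sq_nonneg (s - 1), sq_nonneg (s + 1)]

theorem norm_kaplanskyResolvent_le (x : H →L[ℂ] H) : ‖kaplanskyResolvent x‖ ≤ 1 := by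
  refine norm_cfc_le zero_le_one fun s _ => ?_
  rw [Real.norm_eq_abs, abs_inv, abs_of_pos (by positivity : 0 < 1 + s ^ 2)]
  exact inv_le_one_of_one_le₀ (by nlinarith [sq_nonneg s])

theorem kaplanskyResolvent_mul {x : H →L[ℂ] H} (hx : IsSelfAdjoint x) :
    kaplanskyResolvent x * (1 + x * x) = 1 := by
  have h1 : (1 : H →L[ℂ] H) + x * x = cfc (fun s : ℝ => 1 + s ^ 2) x := by
    rw [cfc_add .., cfc_const_one .., cfc_pow .., cfc_id' .., sq]
  rw [kaplanskyResolvent, h1, ← cfc_mul _ _ x continuous_one_add_sq_inv.continuousOn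
    (by fun_prop)]
  have : (fun s : ℝ => (1 + s ^ 2)⁻¹ * (1 + s ^ 2)) = fun _ => 1 := by
    ext s
    exact inv_mul_cancel₀ (by positivity)
  rw [this, cfc_const_one ..]

theorem mul_kaplanskyResolvent {x : H →L[ℂ] H} (hx : IsSelfAdjoint x) :
    (1 + x * x) * kaplanskyResolvent x = 1 := by
  have h : Commute (kaplanskyResolvent x) (1 + x * x) :=
    (Commute.cfc_real (((Commute.one_right x)).add_right ((Commute.refl x).mul_right
      (Commute.refl x))) _)
  rw [← h.eq, kaplanskyResolvent_mul hx]

theorem kaplanskyTransform_eq {x : H →L[ℂ] H} (hx : IsSelfAdjoint x) :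
    kaplanskyTransform x = (2 : ℂ) • (x * kaplanskyResolvent x) := by
  rw [kaplanskyTransform, cfc_mul _ _ x (by fun_prop) continuous_one_add_sq_inv.continuousOn,
    cfc_const_mul .., cfc_id' .., kaplanskyResolvent, smul_mul_assoc]
  ext v
  simp [two_smul]

theorem kaplanskyTransform_eq' {x : H →L[ℂ] H} (hx : IsSelfAdjoint x) :
    kaplanskyTransform x = (2 : ℂ) • (kaplanskyResolvent x * x) := by
  rw [kaplanskyTransform_eq hx]
  have h : Commute (kaplanskyResolvent x) x := Commute.cfc_real (Commute.refl x) _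
  rw [h.eq]

/-- The identity behind the strong continuity of `x ↦ 2x / (1 + x²)` on self-adjoint operators. -/
theorem kaplanskyTransform_sub {x y : H →L[ℂ] H} (hx : IsSelfAdjoint x) (hy : IsSelfAdjoint y) :
    kaplanskyTransform x - kaplanskyTransform y =
      (2 : ℂ) • (kaplanskyResolvent x * (x - y) * kaplanskyResolvent y) +
      (1 / 2 : ℂ) • (kaplanskyTransform x * (y - x) * kaplanskyTransform y) := by
  have h1 := kaplanskyResolvent_mul hx
  have h2 := mul_kaplanskyResolvent hy
  set p := kaplanskyResolvent x
  set q := kaplanskyResolvent y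
  have e1 : kaplanskyTransform x = (2 : ℂ) • (p * x * ((1 + y * y) * q)) := by
    rw [h2, mul_one, kaplanskyTransform_eq' hx]
  have e2 : kaplanskyTransform y = (2 : ℂ) • ((p * (1 + x * x)) * (y * q)) := by
    rw [h1, one_mul, kaplanskyTransform_eq hy]
  have e3 : kaplanskyTransform x * (y - x) * kaplanskyTransform y =
      (4 : ℂ) • (p * x * (y - x) * (y * q)) := by
    rw [kaplanskyTransform_eq' hx, kaplanskyTransform_eq hy]
    simp only [smul_mul_assoc, mul_smul_comm, smul_smul, p, q]
    norm_num
  rw [e3, e1, e2, smul_smul]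
  norm_num
  rw [← smul_sub, ← smul_add]
  congr 1
  noncomm_ring

theorem kaplanskyTransform_mem {S : StarSubalgebra ℂ (H →L[ℂ] H)}
    (hS : IsClosed (S : Set (H →L[ℂ] H))) {x : H →L[ℂ] H} (hx : x ∈ S) (hsa : IsSelfAdjoint x) :
    kaplanskyTransform x ∈ S := by
  rw [kaplanskyTransform, cfc_real_eq_complex _ hsa]
  exact StarAlgebra.elemental.le_of_mem hS hx (cfc_mem_elemental _ _)

theorem tendsto_kaplanskyTransform {l : Filter (H →L[ℂ] H)} {y : H →L[ℂ] H}
    (hl : ∀ᶠ x in l, IsSelfAdjoint x) (hy : IsSelfAdjoint y)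
    (h : Tendsto (fun a : H →L[ℂ] H => (a : H → H)) l (𝓝 y)) :
    Tendsto (fun a : H →L[ℂ] H => (kaplanskyTransform a : H → H)) l (𝓝 (kaplanskyTransform y)) := by
  rw [tendsto_pi_nhds] at h ⊢
  intro v
  rw [tendsto_iff_norm_sub_tendsto_zero]
  set η₁ := kaplanskyResolvent y v
  set η₂ := kaplanskyTransform y v
  have hlim : Tendsto (fun a : H →L[ℂ] H => 2 * ‖a η₁ - y η₁‖ + 1 / 2 * ‖a η₂ - y η₂‖) l (𝓝 0) := by
    have h1 := (tendsto_iff_norm_sub_tendsto_zero.1 (h η₁)).const_mul 2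
    have h2 := (tendsto_iff_norm_sub_tendsto_zero.1 (h η₂)).const_mul (1 / 2)
    simpa using h1.add h2
  refine squeeze_zero' (Eventually.of_forall fun a => norm_nonneg _) ?_ hlim
  filter_upwards [hl] with a ha
  have hid := congrArg (fun b : H →L[ℂ] H => b v) (kaplanskyTransform_sub ha hy)
  simp only [_root_.sub_apply, _root_.add_apply,
    _root_.smul_apply, mul_apply_eq_comp] at hid
  rw [hid]
  refine (norm_add_le _ _).trans (add_le_add ?_ ?_)
  · rw [norm_smul]
    refine (mul_le_mul_of_nonneg_left ((kaplanskyResolvent a).le_of_opNorm_le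
      (norm_kaplanskyResolvent_le a) _) (norm_nonneg _)).trans ?_
    simp [η₁]
  · rw [norm_smul]
    refine (mul_le_mul_of_nonneg_left ((kaplanskyTransform a).le_of_opNorm_le
      (norm_kaplanskyTransform_le a) _) (norm_nonneg _)).trans ?_
    simp [η₂, norm_sub_rev]

/-- Every self-adjoint contraction is of the form `2y / (1 + y²)`. -/
theorem exists_kaplanskyTransform_eq {t : H →L[ℂ] H} (hsa : IsSelfAdjoint t) (h1 : ‖t‖ ≤ 1) :
    ∃ y : H →L[ℂ] H, IsSelfAdjoint y ∧ kaplanskyTransform y = t ∧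
      ∀ b, Commute t b → Commute y b := by
  let h : ℝ → ℝ := fun s => s * (1 + √(1 - s ^ 2))⁻¹
  have hc : Continuous h := by
    refine continuous_id.mul (Continuous.inv₀ (by fun_prop) fun s => ?_)
    positivity
  refine ⟨cfc h t, cfc_predicate h t, ?_, fun b hb => hb.cfc_real h⟩
  rw [kaplanskyTransform, ← cfc_comp' (fun s : ℝ => 2 * s * (1 + s ^ 2)⁻¹) h t
    (Continuous.continuousOn (Continuous.mul (by fun_prop) continuous_one_add_sq_inv))
    hc.continuousOn hsa]
  conv_rhs => rw [← cfc_id' ℝ t]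
  refine cfc_congr fun s hs => ?_
  have hs1 : |s| ≤ 1 := by
    have := spectrum.norm_le_norm_mul_of_mem hs
    refine (this.trans ?_).trans h1
    exact mul_le_of_le_one_right (norm_nonneg _) ContinuousLinearMap.norm_id_le
  have hs2 : 0 ≤ 1 - s ^ 2 := by
    have := sq_abs s
    nlinarith [abs_nonneg s]
  have hr := Real.sq_sqrt hs2
  have hr0 := Real.sqrt_nonneg (1 - s ^ 2)
  simp only [h]
  set r := √(1 - s ^ 2)
  have hpos : 0 < 1 + r := by positivity
  have hpos2 : (1 + r) ^ 2 + s ^ 2 = 2 * (1 + r) := by nlinarith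
  have : 1 + (s * (1 + r)⁻¹) ^ 2 = 2 * (1 + r)⁻¹ := by
    field_simp
    linarith
  rw [this]
  field_simp

theorem mem_closure_coe_of_isSelfAdjoint_of_norm_le_one {S : StarSubalgebra ℂ (H →L[ℂ] H)}
    (hS : IsClosed (S : Set (H →L[ℂ] H))) {t : H →L[ℂ] H}
    (ht : t ∈ Set.centralizer (Set.centralizer (S : Set (H →L[ℂ] H)))) (hsa : IsSelfAdjoint t)
    (h1 : ‖t‖ ≤ 1) :
    (t : H → H) ∈ closure ((fun a : H →L[ℂ] H => (a : H → H)) '' {a | a ∈ S ∧ ‖a‖ ≤ 1}) := by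
  obtain ⟨y, hy, rfl, hcomm⟩ := exists_kaplanskyTransform_eq hsa h1
  have hy' : y ∈ Set.centralizer (Set.centralizer (S : Set (H →L[ℂ] H))) := fun b hb =>
    (hcomm b (ht b hb).symm).symm
  obtain ⟨l, hl, hs, hlim⟩ := exists_filter_tendsto_of_mem_closure_image
    (mem_closure_coe_isSelfAdjoint S hy' hy)
  refine mem_closure_of_tendsto (tendsto_kaplanskyTransform (mem_of_superset hs fun a ha => ha.2)
    hy hlim) (mem_of_superset hs fun a ha => ?_)
  exact ⟨_, ⟨kaplanskyTransform_mem hS ha.1 ha.2, norm_kaplanskyTransform_le a⟩, rfl⟩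

/-- Kaplansky's density theorem, up to a constant: an element of the bicommutant of a norm closed
⋆-algebra of operators is a strong limit of a bounded net in the algebra. -/
theorem exists_bounded_filter_of_mem_bicommutant {S : StarSubalgebra ℂ (H →L[ℂ] H)}
    (hS : IsClosed (S : Set (H →L[ℂ] H))) {t : H →L[ℂ] H}
    (ht : t ∈ Set.centralizer (Set.centralizer (S : Set (H →L[ℂ] H)))) :
    ∃ (C : ℝ) (l : Filter (H →L[ℂ] H)), l.NeBot ∧ (∀ᶠ a in l, a ∈ S ∧ ‖a‖ ≤ C) ∧
      ∀ x, Tendsto (fun a => a x) l (𝓝 (t x)) := by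
  suffices hmain : ∃ C : ℝ, (t : H → H) ∈
      closure ((fun a : H →L[ℂ] H => (a : H → H)) '' {a | a ∈ S ∧ ‖a‖ ≤ C}) by
    obtain ⟨C, hC⟩ := hmain
    obtain ⟨l, hl, hs, hlim⟩ := exists_filter_tendsto_of_mem_closure_image hC
    exact ⟨C, l, hl, hs, tendsto_pi_nhds.1 hlim⟩
  have hsa : ∀ s : H →L[ℂ] H, s ∈ Set.centralizer (Set.centralizer (S : Set (H →L[ℂ] H))) →
      IsSelfAdjoint s → ∃ C : ℝ, (s : H → H) ∈
      closure ((fun a : H →L[ℂ] H => (a : H → H)) '' {a | a ∈ S ∧ ‖a‖ ≤ C}) := by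
    intro s hs hs'
    have hn : 0 < ‖s‖ + 1 := by positivity
    have hmem := mem_closure_coe_of_isSelfAdjoint_of_norm_le_one hS (t := (‖s‖ + 1)⁻¹ • s)
      (fun b hb => by rw [mul_smul_comm, smul_mul_assoc, hs b hb])
      (isSelfAdjoint_real_smul _ hs') (by
        rw [norm_smul, Real.norm_of_nonneg (by positivity), inv_mul_le_iff₀ hn]
        linarith)
    refine ⟨‖s‖ + 1, ?_⟩
    rw [mem_closure_image_coe_iff] at hmem ⊢
    intro F ε hε
    obtain ⟨a, ⟨ha, ha1⟩, haF⟩ := hmem F (ε / (‖s‖ + 1)) (by positivity)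
    refine ⟨(‖s‖ + 1) • a, ⟨?_, ?_⟩, fun x hx => ?_⟩
    · exact S.real_smul_mem _ ha
    · rw [norm_smul, Real.norm_of_nonneg hn.le]
      exact mul_le_of_le_one_right hn.le ha1
    · have h2 := haF x hx
      rw [lt_div_iff₀ hn] at h2
      have h3 : ((‖s‖ + 1) • a) x - s x = (‖s‖ + 1) • (a x - ((‖s‖ + 1)⁻¹ • s) x) := by
        rw [smul_sub, _root_.smul_apply, _root_.smul_apply, smul_smul,
          mul_inv_cancel₀ hn.ne', one_smul]
      rw [h3, norm_smul, Real.norm_of_nonneg hn.le, mul_comm]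
      exact h2
  have hcent : star t ∈ Set.centralizer (Set.centralizer (S : Set (H →L[ℂ] H))) := by
    refine Set.star_mem_centralizer' (fun b hb => ?_) ht
    exact Set.star_mem_centralizer' (fun c hc => star_mem hc) hb
  obtain ⟨C₁, h1⟩ := hsa (t + star t)
    (fun b hb => by rw [mul_add, add_mul, ht b hb, hcent b hb]) (IsSelfAdjoint.add_star_self t)
  obtain ⟨C₂, h2⟩ := hsa (Complex.I • (t - star t))
    (fun b hb => by rw [mul_smul_comm, smul_mul_assoc, mul_sub, sub_mul, ht b hb, hcent b hb])
    (by rw [isSelfAdjoint_iff]; simp [star_smul, ← smul_neg])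
  refine ⟨C₁ + C₂, ?_⟩
  rw [mem_closure_image_coe_iff] at h1 h2 ⊢
  intro F ε hε
  obtain ⟨a, ⟨ha, ha1⟩, haF⟩ := h1 F ε hε
  obtain ⟨b, ⟨hb, hb1⟩, hbF⟩ := h2 F ε hε
  have hC1 : 0 ≤ C₁ := (norm_nonneg a).trans ha1
  have hC2 : 0 ≤ C₂ := (norm_nonneg b).trans hb1
  refine ⟨(1 / 2 : ℂ) • (a - Complex.I • b), ⟨S.smul_mem (sub_mem ha (S.smul_mem hb _)) _, ?_⟩,
    fun x hx => ?_⟩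
  · rw [norm_smul]
    have : ‖a - Complex.I • b‖ ≤ C₁ + C₂ := by
      refine (norm_sub_le _ _).trans (add_le_add ha1 ?_)
      rw [norm_smul, Complex.norm_I, one_mul]
      exact hb1
    norm_num
    linarith [norm_nonneg (a - Complex.I • b)]
  · have h3 : ((1 / 2 : ℂ) • (a - Complex.I • b)) x - t x =
        (1 / 2 : ℂ) • ((a x - (t + star t) x) -
          Complex.I • (b x - (Complex.I • (t - star t)) x)) := by
      simp only [_root_.smul_apply, _root_.sub_apply,
        _root_.add_apply]
      rw [smul_sub Complex.I, smul_smul Complex.I Complex.I, Complex.I_mul_I]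
      module
    rw [h3, norm_smul]
    have h4 : ‖(a x - (t + star t) x) - Complex.I • (b x - (Complex.I • (t - star t)) x)‖ <
        ε + ε := by
      refine (norm_sub_le _ _).trans_lt (add_lt_add (haF x hx) ?_)
      rw [norm_smul, Complex.norm_I, one_mul]
      exact hbF x hx
    rw [show ‖(1 / 2 : ℂ)‖ = 1 / 2 by norm_num]
    linarith

end Kaplansky

/-! ### Weak limits of bounded nets of operators -/

section WeakLimits

variable {H : Type*} [NormedAddCommGroup H] [InnerProductSpace ℂ H] [CompleteSpace H]

/-- Balls of bounded operators are compact in the weak operator topology. -/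
theorem exists_weak_limit {α : Type*} (u : Ultrafilter α) {d : α → H →L[ℂ] H} {C : ℝ}
    (hd : ∀ᶠ i in (u : Filter α), ‖d i‖ ≤ C) :
    ∃ b : H →L[ℂ] H, ‖b‖ ≤ C ∧
      ∀ ξ η, Tendsto (fun i => ⟪ξ, d i η⟫_ℂ) u (𝓝 ⟪ξ, b η⟫_ℂ) := by
  have hC : 0 ≤ C := by
    obtain ⟨i, hi⟩ := hd.exists
    exact (norm_nonneg _).trans hi
  have hbd : ∀ ξ η, ∀ᶠ i in (u : Filter α),
      ⟪ξ, d i η⟫_ℂ ∈ Metric.closedBall (0 : ℂ) (C * ‖ξ‖ * ‖η‖) := by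
    intro ξ η
    filter_upwards [hd] with i hi
    rw [mem_closedBall_zero_iff]
    refine (norm_inner_le_norm _ _).trans ?_
    have := (d i).le_of_opNorm_le hi η
    nlinarith [norm_nonneg ξ]
  have hlim : ∀ ξ η, ∃ z ∈ Metric.closedBall (0 : ℂ) (C * ‖ξ‖ * ‖η‖),
      Tendsto (fun i => ⟪ξ, d i η⟫_ℂ) u (𝓝 z) := by
    intro ξ η
    exact (isCompact_closedBall (0 : ℂ) _).ultrafilter_le_nhds (u.map _)
      (le_principal_iff.2 (hbd ξ η))
  choose B hB hBlim using hlim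
  -- the limits of the matrix elements form a bounded sesquilinear form
  let B' : H →ₗ⋆[ℂ] H →ₗ[ℂ] ℂ := LinearMap.mk₂'ₛₗ (starRingEnd ℂ) (RingHom.id ℂ) B
    (fun ξ ξ' η => tendsto_nhds_unique (hBlim _ _) (by
      simpa only [inner_add_left] using (hBlim ξ η).add (hBlim ξ' η)))
    (fun c ξ η => tendsto_nhds_unique (hBlim _ _) (by
      simpa only [inner_smul_left, smul_eq_mul] using (hBlim ξ η).const_mul (starRingEnd ℂ c)))
    (fun ξ η η' => tendsto_nhds_unique (hBlim _ _) (by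
      simpa only [map_add, inner_add_right] using (hBlim ξ η).add (hBlim ξ η')))
    (fun c ξ η => tendsto_nhds_unique (hBlim _ _) (by
      simpa only [map_smul, inner_smul_right, smul_eq_mul, RingHom.id_apply] using
        (hBlim ξ η).const_mul c))
  have hB'bd : ∀ ξ η, ‖B' ξ η‖ ≤ C * ‖ξ‖ * ‖η‖ := fun ξ η => mem_closedBall_zero_iff.1 (hB ξ η)
  let b := ContinuousLinearMap.adjoint
    (InnerProductSpace.continuousLinearMapOfBilin (B'.mkContinuous₂ C hB'bd))
  have hb : ∀ ξ η, ⟪ξ, b η⟫_ℂ = B ξ η := by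
    intro ξ η
    rw [ContinuousLinearMap.adjoint_inner_right,
      InnerProductSpace.continuousLinearMapOfBilin_apply]
    rfl
  refine ⟨b, ContinuousLinearMap.opNorm_le_bound _ hC fun η => ?_, fun ξ η => hb ξ η ▸ hBlim ξ η⟩
  have h1 : ‖b η‖ * ‖b η‖ ≤ (C * ‖η‖) * ‖b η‖ := by
    rw [← inner_self_eq_norm_mul_norm (𝕜 := ℂ)]
    refine (RCLike.re_le_norm _).trans ?_
    rw [hb]
    refine (hB'bd _ _).trans (le_of_eq ?_)
    ring
  rcases (norm_nonneg (b η)).eq_or_lt with h | h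
  · rw [← h]; positivity
  · exact le_of_mul_le_mul_right h1 h

/-- Commutants are closed in the weak operator topology. -/
theorem mem_centralizer_of_weak_limit {α : Type*} {l : Filter α} [l.NeBot] {d : α → H →L[ℂ] H}
    {b : H →L[ℂ] H} (hb : ∀ ξ η, Tendsto (fun i => ⟪ξ, d i η⟫_ℂ) l (𝓝 ⟪ξ, b η⟫_ℂ))
    {R : Set (H →L[ℂ] H)} (hd : ∀ᶠ i in l, d i ∈ Set.centralizer R) : b ∈ Set.centralizer R := by
  intro r hr
  ext η
  refine ext_inner_left ℂ fun ξ => ?_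
  rw [mul_apply_eq_comp, mul_apply_eq_comp,
    ← ContinuousLinearMap.adjoint_inner_left]
  refine tendsto_nhds_unique (hb _ _) ((hb ξ (r η)).congr' ?_)
  filter_upwards [hd] with i hi
  rw [ContinuousLinearMap.adjoint_inner_left]
  exact congrArg (fun a : H →L[ℂ] H => ⟪ξ, a η⟫_ℂ) (hi r hr).symm

theorem VonNeumannAlgebra.mem_of_weak_limit (M : VonNeumannAlgebra H) {α : Type*} {l : Filter α}
    [l.NeBot] {d : α → H →L[ℂ] H} {b : H →L[ℂ] H}
    (hb : ∀ ξ η, Tendsto (fun i => ⟪ξ, d i η⟫_ℂ) l (𝓝 ⟪ξ, b η⟫_ℂ))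
    (hd : ∀ᶠ i in l, d i ∈ M) : b ∈ M := by
  rw [← SetLike.mem_coe, ← M.centralizer_centralizer]
  refine mem_centralizer_of_weak_limit hb ?_
  filter_upwards [hd] with i hi
  rw [M.centralizer_centralizer]
  exact hi

/-- On bounded nets, weak operator convergence implies σ-weak convergence. -/
theorem IsNormalFunctional.tendsto {M : VonNeumannAlgebra H} {f : M.Elem → ℂ}
    (hf : IsNormalFunctional M f) {α : Type*} {l : Filter α} {d : α → M.Elem} {b : M.Elem} {C : ℝ}
    (hd : ∀ᶠ i in l, ‖d i‖ ≤ C)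
    (hb : ∀ ξ η, Tendsto (fun i => ⟪ξ, (d i : H →L[ℂ] H) η⟫_ℂ) l (𝓝 ⟪ξ, (b : H →L[ℂ] H) η⟫_ℂ)) :
    Tendsto (fun i => f (d i)) l (𝓝 (f b)) := by
  refine Tendsto.comp (@Continuous.tendsto _ _ (_) _ _ hf b) ?_
  rw [@nhds_induced, tendsto_comap_iff, sigmaWeakTopology, @nhds_iInf, tendsto_iInf]
  rintro ⟨⟨ξ, η⟩, hξ, hη⟩
  rw [@nhds_induced, tendsto_comap_iff]
  have hsum : Summable fun n => C * (‖ξ n‖ ^ 2 + ‖η n‖ ^ 2) := (hξ.add hη).mul_left C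
  refine tendsto_tsum_of_dominated_convergence hsum (fun n => hb (ξ n) (η n)) ?_
  filter_upwards [hd] with i hi n
  have hC : 0 ≤ C := (norm_nonneg _).trans hi
  refine (norm_inner_le_norm _ _).trans ?_
  have h1 : ‖(d i : H →L[ℂ] H) (η n)‖ ≤ C * ‖η n‖ := ContinuousLinearMap.le_of_opNorm_le _ hi _
  have h2 : ‖ξ n‖ * ‖η n‖ ≤ ‖ξ n‖ ^ 2 + ‖η n‖ ^ 2 := by nlinarith [sq_nonneg (‖ξ n‖ - ‖η n‖)]
  calc ‖ξ n‖ * ‖(d i : H →L[ℂ] H) (η n)‖ ≤ ‖ξ n‖ * (C * ‖η n‖) := by gcongr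
    _ = C * (‖ξ n‖ * ‖η n‖) := by ring
    _ ≤ _ := by gcongr

end WeakLimits

/-! ### The GNS representation of a faithful normal state -/

namespace WStarSystem

variable {G : Type*} [Group G]
variable {K : Type*} [NormedAddCommGroup K] [InnerProductSpace ℂ K] [CompleteSpace K]
variable (A : WStarSystem G K)

/-- The linear map `a ↦ π_μ(a) Ω_μ` from the algebra into the GNS space. -/
noncomputable def vec : A.alg.Elem →ₗ[ℂ] A.H where
  toFun a := A.rep a A.cyclicVector
  map_add' a b := by rw [map_add, _root_.add_apply]
  map_smul' c a := by rw [map_smul, _root_.smul_apply, RingHom.id_apply]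

theorem rep_cyclicVector (a : A.alg.Elem) : A.rep a A.cyclicVector = A.vec a := rfl

theorem rep_coe (a b : A.alg.Elem) :
    A.rep a ((A.state.toPreGNS b : A.state.PreGNS) : A.H) =
      (A.state.toPreGNS (a * b) : A.state.PreGNS) := by
  change A.state.gnsNonUnitalStarAlgHom a _ = _
  rw [PositiveLinearMap.gnsNonUnitalStarAlgHom_apply_coe,
    PositiveLinearMap.leftMulMapPreGNS_apply]
  rfl

theorem vec_eq_coe (a : A.alg.Elem) : A.vec a = (A.state.toPreGNS a : A.state.PreGNS) := by
  rw [← rep_cyclicVector, cyclicVector, rep_coe, mul_one]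

theorem vec_one : A.vec 1 = A.cyclicVector := A.vec_eq_coe 1

theorem rep_vec (a b : A.alg.Elem) : A.rep a (A.vec b) = A.vec (a * b) := by
  rw [vec_eq_coe, vec_eq_coe, rep_coe]

theorem inner_vec (a b : A.alg.Elem) : ⟪A.vec a, A.vec b⟫_ℂ = A.state (star a * b) := by
  rw [vec_eq_coe, vec_eq_coe, UniformSpace.Completion.inner_coe]
  rfl

theorem denseRange_vec : DenseRange A.vec := by
  have h : (A.vec : A.alg.Elem → A.H) =
      (fun x : A.state.PreGNS => (x : A.H)) ∘ A.state.toPreGNS := funext A.vec_eq_coe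
  rw [h]
  exact UniformSpace.Completion.denseRange_coe.comp A.state.toPreGNS.surjective.denseRange
    (UniformSpace.Completion.continuous_coe _)

theorem vec_injective : Function.Injective A.vec := by
  rw [injective_iff_map_eq_zero]
  intro a ha
  refine A.faithful a ?_
  rw [← inner_vec, ha, inner_zero_left]

theorem rep_injective : Function.Injective A.rep := fun a b h =>
  A.vec_injective (by rw [← rep_cyclicVector, ← rep_cyclicVector, h])

theorem norm_rep (a : A.alg.Elem) : ‖A.rep a‖ = ‖a‖ :=
  NonUnitalStarAlgHom.norm_map A.rep A.rep_injective a

theorem norm_cyclicVector : ‖A.cyclicVector‖ = 1 := by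
  have h : ⟪A.cyclicVector, A.cyclicVector⟫_ℂ = 1 := by
    rw [← vec_one, inner_vec, star_one, one_mul, A.state_one]
  rw [inner_self_eq_norm_sq_to_K] at h
  have h2 : ‖A.cyclicVector‖ ^ 2 = 1 := Complex.ofReal_injective (by simpa using! h)
  exact (pow_eq_one_iff_of_nonneg (norm_nonneg _) two_ne_zero).1 h2

theorem eq_of_forall_inner_vec {x y : A.H} (h : ∀ c, ⟪A.vec c, x⟫_ℂ = ⟪A.vec c, y⟫_ℂ) :
    x = y := by
  refine ext_inner_left ℂ fun z => ?_
  exact congrFun (A.denseRange_vec.equalizer (g := fun z => ⟪z, x⟫_ℂ) (h := fun z => ⟪z, y⟫_ℂ)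
    (by fun_prop) (by fun_prop) (funext h)) z

theorem unitary_vec (g : G) (a : A.alg.Elem) : A.unitary g (A.vec a) = A.vec (A.action g a) := by
  rw [vec_eq_coe, vec_eq_coe]
  exact UniformSpace.Completion.map_coe (A.preUnitary g).uniformContinuous _

theorem ext_vec {f h : A.H →L[ℂ] A.H} (H : ∀ a, f (A.vec a) = h (A.vec a)) : f = h :=
  DFunLike.coe_injective (A.denseRange_vec.equalizer f.continuous h.continuous (funext H))

theorem unitary_mul (g h : G) : A.unitary (g * h) = A.unitary g * A.unitary h := by
  refine A.ext_vec fun a => ?_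
  rw [mul_apply_eq_comp]
  simp only [unitary_vec, map_mul]
  rfl

theorem unitary_mul_apply (g h : G) (x : A.H) :
    A.unitary (g * h) x = A.unitary g (A.unitary h x) := by
  rw [unitary_mul, mul_apply_eq_comp]

theorem unitary_one_apply (x : A.H) : A.unitary 1 x = x := by
  have h : A.unitary 1 = 1 := by
    refine A.ext_vec fun a => ?_
    rw [unitary_vec, map_one]
    rfl
  rw [h]
  rfl

theorem norm_unitary_apply (g : G) (x : A.H) : ‖A.unitary g x‖ = ‖x‖ := by
  refine congrFun (A.denseRange_vec.equalizer (g := fun x => ‖A.unitary g x‖) (h := fun x => ‖x‖)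
    (by fun_prop) (by fun_prop) (funext fun a => ?_)) x
  have h : ⟪A.unitary g (A.vec a), A.unitary g (A.vec a)⟫_ℂ = ⟪A.vec a, A.vec a⟫_ℂ := by
    rw [unitary_vec, inner_vec, inner_vec, ← map_star, ← map_mul, A.invariant]
  change ‖A.unitary g (A.vec a)‖ = ‖A.vec a‖
  rw [norm_eq_sqrt_re_inner (𝕜 := ℂ), h, ← norm_eq_sqrt_re_inner]

/-- The unitary representation `g ↦ U_g` on the GNS space. -/
noncomputable def unitaryHom : G →* (A.H ≃ₗᵢ[ℂ] A.H) where
  toFun g :=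
    { (A.unitary g : A.H →ₗ[ℂ] A.H) with
      invFun := A.unitary g⁻¹
      left_inv := fun x => by
        change A.unitary g⁻¹ (A.unitary g x) = x
        rw [← unitary_mul_apply, inv_mul_cancel, unitary_one_apply]
      right_inv := fun x => by
        change A.unitary g (A.unitary g⁻¹ x) = x
        rw [← unitary_mul_apply, mul_inv_cancel, unitary_one_apply]
      norm_map' := A.norm_unitary_apply g }
  map_one' := LinearIsometryEquiv.ext A.unitary_one_apply
  map_mul' g h := LinearIsometryEquiv.ext (A.unitary_mul_apply g h)

theorem inner_unitary_unitary (g : G) (x y : A.H) :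
    ⟪A.unitary g x, A.unitary g y⟫_ℂ = ⟪x, y⟫_ℂ := (A.unitaryHom g).inner_map_map x y

theorem star_unitary (g : G) : star (A.unitary g) = A.unitary g⁻¹ := by
  rw [ContinuousLinearMap.star_eq_adjoint, eq_comm, ContinuousLinearMap.eq_adjoint_iff]
  intro x y
  rw [← A.inner_unitary_unitary g, ← unitary_mul_apply, mul_inv_cancel, unitary_one_apply]

/-- `U_g π_μ(a) = π_μ(α_g(a)) U_g`. -/
theorem unitary_rep_apply (g : G) (a : A.alg.Elem) (x : A.H) :
    A.unitary g (A.rep a x) = A.rep (A.action g a) (A.unitary g x) := by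
  have h : A.unitary g * A.rep a = A.rep (A.action g a) * A.unitary g := by
    refine A.ext_vec fun b => ?_
    simp only [mul_apply_eq_comp, unitary_vec, rep_vec, map_mul]
  exact congrArg (fun b : A.H →L[ℂ] A.H => b x) h

/-- The GNS representation is continuous on bounded sets for the weak operator topologies. -/
theorem rep_weak_tendsto {α : Type*} (u : Ultrafilter α) {d : α → A.alg.Elem} {b : A.alg.Elem}
    {C : ℝ} (hd : ∀ᶠ i in (u : Filter α), ‖d i‖ ≤ C)
    (hb : ∀ ξ η, Tendsto (fun i => ⟪ξ, (d i : K →L[ℂ] K) η⟫_ℂ) u (𝓝 ⟪ξ, (b : K →L[ℂ] K) η⟫_ℂ))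
    (x y : A.H) : Tendsto (fun i => ⟪x, A.rep (d i) y⟫_ℂ) u (𝓝 ⟪x, A.rep b y⟫_ℂ) := by
  obtain ⟨t, -, ht⟩ := exists_weak_limit u (d := fun i => A.rep (d i)) (C := C)
    (hd.mono fun i hi => (A.norm_rep _).trans_le hi)
  suffices h : A.rep b = t by rw [h]; exact ht x y
  refine A.ext_vec fun e => ?_
  refine A.eq_of_forall_inner_vec fun c => ?_
  refine tendsto_nhds_unique ?_ (ht _ _)
  simp only [rep_vec, inner_vec]
  refine A.normal.tendsto (C := ‖star c‖ * (C * ‖e‖)) ?_ fun ξ η => ?_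
  · filter_upwards [hd] with i hi
    refine (norm_mul_le _ _).trans ?_
    gcongr
    exact (norm_mul_le _ _).trans (by gcongr)
  · simp only [map_mul, map_star, mul_apply_eq_comp, ContinuousLinearMap.star_eq_adjoint,
      ContinuousLinearMap.adjoint_inner_right]
    exact hb _ _

/-- A bounded family in the algebra has a weak limit point in it. -/
theorem exists_weak_limit_elem {α : Type*} (u : Ultrafilter α) {d : α → A.alg.Elem} {C : ℝ}
    (hd : ∀ᶠ i in (u : Filter α), ‖d i‖ ≤ C) :
    ∃ b : A.alg.Elem, ‖b‖ ≤ C ∧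
      ∀ ξ η, Tendsto (fun i => ⟪ξ, (d i : K →L[ℂ] K) η⟫_ℂ) u (𝓝 ⟪ξ, (b : K →L[ℂ] K) η⟫_ℂ) := by
  obtain ⟨b, hbC, hb⟩ := exists_weak_limit u (d := fun i => (d i : K →L[ℂ] K)) hd
  have hbA : b ∈ A.alg :=
    A.alg.mem_of_weak_limit hb (Eventually.of_forall fun i => Subtype.prop (d i))
  exact ⟨⟨b, hbA⟩, hbC, hb⟩

/-- The vectors `π_μ(d) Ω_μ`, with `d` in a ball of a von Neumann subalgebra, form a closed set:
such a ball is weakly compact, and the state is normal. -/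
theorem isClosed_vec_ball (M : VonNeumannAlgebra K) (C : ℝ) :
    IsClosed (A.vec '' {d | (d : K →L[ℂ] K) ∈ M ∧ ‖d‖ ≤ C}) := by
  refine isClosed_of_closure_subset fun x hx => ?_
  obtain ⟨l, hl, hs, hlim⟩ := exists_filter_tendsto_of_mem_closure_image hx
  have hs' := (Ultrafilter.of_le l) hs
  have hd : ∀ᶠ d in (Ultrafilter.of l : Filter A.alg.Elem), ‖d‖ ≤ C :=
    mem_of_superset hs' fun d h => h.2
  obtain ⟨b, hbC, hb⟩ := A.exists_weak_limit_elem (Ultrafilter.of l) (d := fun d => d) hd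
  refine ⟨b, ⟨M.mem_of_weak_limit hb (mem_of_superset hs' fun d h => h.1), hbC⟩, ?_⟩
  refine A.eq_of_forall_inner_vec fun c => ?_
  exact tendsto_nhds_unique (A.rep_weak_tendsto _ hd hb (A.vec c) A.cyclicVector)
    (tendsto_const_nhds.inner (hlim.mono_left (Ultrafilter.of_le l)))

/-- The image under the GNS representation of a von Neumann subalgebra is a von Neumann algebra. -/
theorem exists_vonNeumannAlgebra_eq_rep_image (M : VonNeumannAlgebra K) :
    ∃ N : VonNeumannAlgebra A.H,
      (N : Set (A.H →L[ℂ] A.H)) = A.rep '' {d | (d : K →L[ℂ] K) ∈ M} := by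
  let S₀ : StarSubalgebra ℂ A.alg.Elem := M.toStarSubalgebra.comap A.alg.incl
  let S : StarSubalgebra ℂ (A.H →L[ℂ] A.H) := S₀.map A.rep
  have hS : (S : Set (A.H →L[ℂ] A.H)) = A.rep '' {d | (d : K →L[ℂ] K) ∈ M} := rfl
  have hiso : Isometry A.rep := AddMonoidHomClass.isometry_of_norm A.rep A.norm_rep
  have hincl : Continuous A.alg.incl := continuous_subtype_val
  have hcl : IsClosed (S : Set (A.H →L[ℂ] A.H)) := by
    rw [hS]
    exact hiso.isClosedEmbedding.isClosedMap _
      ((VonNeumannAlgebra.instIsClosedCoe M).preimage hincl)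
  refine ⟨⟨S, Set.Subset.antisymm (fun t ht => ?_) Set.subset_centralizer_centralizer⟩, hS⟩
  obtain ⟨C, l, hl, hlS, hlim⟩ := exists_bounded_filter_of_mem_bicommutant hcl ht
  have hmem : (t : A.H → A.H) ∈ closure ((fun d => (A.rep d : A.H → A.H)) ''
      {d | (d : K →L[ℂ] K) ∈ M ∧ ‖d‖ ≤ C}) := by
    refine mem_closure_of_tendsto (tendsto_pi_nhds.2 hlim) (hlS.mono ?_)
    rintro _ ⟨⟨d, hd, rfl⟩, hdC⟩
    exact ⟨d, ⟨hd, (A.norm_rep d).symm.trans_le hdC⟩, rfl⟩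
  obtain ⟨l', hl', hs, hlim'⟩ := exists_filter_tendsto_of_mem_closure_image hmem
  have hs' := (Ultrafilter.of_le l') hs
  have hd : ∀ᶠ d in (Ultrafilter.of l' : Filter A.alg.Elem), ‖d‖ ≤ C :=
    mem_of_superset hs' fun d h => h.2
  obtain ⟨b, -, hb⟩ := A.exists_weak_limit_elem (Ultrafilter.of l') (d := fun d => d) hd
  refine ⟨b, M.mem_of_weak_limit hb (mem_of_superset hs' fun d h => h.1), ?_⟩
  ext x
  refine ext_inner_left ℂ fun y => ?_
  exact tendsto_nhds_unique (A.rep_weak_tendsto _ hd hb y x)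
    (tendsto_const_nhds.inner ((tendsto_pi_nhds.1 hlim' x).mono_left (Ultrafilter.of_le l')))

/-- The preimage under the GNS representation of a von Neumann algebra is a von Neumann algebra. -/
theorem exists_vonNeumannAlgebra_eq_rep_preimage (R : VonNeumannAlgebra A.H) :
    ∃ N : VonNeumannAlgebra K, (N : Set (K →L[ℂ] K)) = A.alg.incl '' {d | A.rep d ∈ R} := by
  let S₀ : StarSubalgebra ℂ A.alg.Elem := R.toStarSubalgebra.comap A.rep
  let S : StarSubalgebra ℂ (K →L[ℂ] K) := S₀.map A.alg.incl
  have hS : (S : Set (K →L[ℂ] K)) = A.alg.incl '' {d | A.rep d ∈ R} := rfl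
  have hiso : Isometry A.rep := AddMonoidHomClass.isometry_of_norm A.rep A.norm_rep
  have hincl : Isometry A.alg.incl := isometry_subtype_coe
  have hcl : IsClosed (S : Set (K →L[ℂ] K)) := by
    rw [hS]
    exact hincl.isClosedEmbedding.isClosedMap _
      ((VonNeumannAlgebra.instIsClosedCoe R).preimage hiso.continuous)
  refine ⟨⟨S, Set.Subset.antisymm (fun t ht => ?_) Set.subset_centralizer_centralizer⟩, hS⟩
  obtain ⟨C, l, hl, hlS, hlim⟩ := exists_bounded_filter_of_mem_bicommutant hcl ht
  have hmem : (t : K → K) ∈ closure ((fun d : A.alg.Elem => ((d : K →L[ℂ] K) : K → K)) ''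
      {d | A.rep d ∈ R ∧ ‖d‖ ≤ C}) := by
    refine mem_closure_of_tendsto (tendsto_pi_nhds.2 hlim) (hlS.mono ?_)
    rintro _ ⟨⟨d, hd, rfl⟩, hdC⟩
    exact ⟨d, ⟨hd, hdC⟩, rfl⟩
  obtain ⟨l', hl', hs, hlim'⟩ := exists_filter_tendsto_of_mem_closure_image hmem
  have hs' := (Ultrafilter.of_le l') hs
  have hd : ∀ᶠ d in (Ultrafilter.of l' : Filter A.alg.Elem), ‖d‖ ≤ C :=
    mem_of_superset hs' fun d h => h.2
  obtain ⟨b, -, hb⟩ := A.exists_weak_limit_elem (Ultrafilter.of l') (d := fun d => d) hd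
  refine ⟨b, R.mem_of_weak_limit (A.rep_weak_tendsto _ hd hb)
    (mem_of_superset hs' fun d h => h.1), ?_⟩
  ext x
  refine ext_inner_left ℂ fun y => ?_
  exact tendsto_nhds_unique (hb y x)
    (tendsto_const_nhds.inner ((tendsto_pi_nhds.1 hlim' x).mono_left (Ultrafilter.of_le l')))

end WStarSystem

/-! ### Fixed points of commuting maps -/

/-- The Markov–Kakutani fixed point theorem, for continuous linear maps which leave a compact
convex set invariant. -/
theorem exists_forall_map_eq_of_commute {E : Type*} [NormedAddCommGroup E] [NormedSpace ℝ E]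
    {ι : Type*} {C : Set E} (hC : IsCompact C) (hconv : Convex ℝ C) (hne : C.Nonempty)
    (T : ι → E →L[ℝ] E) (hT : ∀ i j, Commute (T i) (T j)) (hmaps : ∀ i, Set.MapsTo (T i) C C) :
    ∃ x ∈ C, ∀ i, T i x = x := by
  let avg : ι → ℕ → E →L[ℝ] E := fun i n =>
    ((n : ℝ) + 1)⁻¹ • ∑ k ∈ Finset.range (n + 1), (T i) ^ (k : ℕ)
  let 𝒮 : Submonoid (E →L[ℝ] E) := Submonoid.closure {S | ∃ i n, S = avg i n}
  have hcomm : ∀ S ∈ 𝒮, ∀ S' ∈ 𝒮, Commute S S' := by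
    intro S hS S' hS'
    induction hS, hS' using Submonoid.closure_induction₂ with
    | mem S S' hS hS' =>
      obtain ⟨i, n, rfl⟩ := hS
      obtain ⟨j, m, rfl⟩ := hS'
      refine Commute.smul_left (Commute.smul_right (M := ℝ) ?_ _) _
      refine Commute.sum_left _ _ _ fun k _ => Commute.sum_right _ _ _ fun l _ => ?_
      exact (hT i j).pow_pow k l
    | one_left S _ => exact Commute.one_left S
    | one_right S _ => exact Commute.one_right S
    | mul_left _ _ _ _ _ _ h1 h2 => exact h1.mul_left h2
    | mul_right _ _ _ _ _ _ h1 h2 => exact h1.mul_right h2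
  have hpow : ∀ (i : ι) (k : ℕ), Set.MapsTo (T i ^ k) C C := by
    intro i k
    induction k with
    | zero => exact Set.mapsTo_id C
    | succ k ih =>
      rw [pow_succ]
      exact ih.comp (hmaps i)
  have hmaps' : ∀ S ∈ 𝒮, Set.MapsTo S C C := by
    intro S hS
    induction hS using Submonoid.closure_induction with
    | mem S hS =>
      obtain ⟨i, n, rfl⟩ := hS
      intro x hx
      have : avg i n x = ∑ k ∈ Finset.range (n + 1), ((n : ℝ) + 1)⁻¹ • (T i ^ k) x := by
        simp only [avg, _root_.smul_apply, _root_.sum_apply, Finset.smul_sum]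
      rw [this]
      refine hconv.sum_mem (fun _ _ => by positivity) ?_ fun k _ => hpow i k hx
      rw [Finset.sum_const, Finset.card_range, nsmul_eq_mul]
      push_cast
      exact mul_inv_cancel₀ (by positivity)
    | one => exact Set.mapsTo_id C
    | mul S S' _ _ h1 h2 => exact h1.comp h2
  have hmul : ∀ (S S' : E →L[ℝ] E) (x : E), (S * S') x = S (S' x) := fun _ _ _ => rfl
  obtain ⟨x, hx⟩ := IsCompact.nonempty_iInter_of_directed_nonempty_isCompact_isClosed
    (fun S : 𝒮 => (S : E →L[ℝ] E) '' C)
    (fun S S' => ⟨S * S', by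
      rintro _ ⟨x, hx, rfl⟩
      exact ⟨_, hmaps' _ S'.2 hx, rfl⟩, by
      rintro _ ⟨x, hx, rfl⟩
      refine ⟨_, hmaps' _ S.2 hx, ?_⟩
      rw [Submonoid.coe_mul, (hcomm _ S.2 _ S'.2).eq, hmul]⟩)
    (fun S => hne.image _)
    (fun S => hC.image (S : E →L[ℝ] E).continuous)
    (fun S => (hC.image (S : E →L[ℝ] E).continuous).isClosed)
  rw [Set.mem_iInter] at hx
  obtain ⟨D, hD⟩ := hC.isBounded.exists_norm_le
  refine ⟨x, ?_, fun i => ?_⟩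
  · obtain ⟨y, hy, hyx⟩ := hx 1
    rw [← hyx]
    exact hy
  · have hbound : ∀ n : ℕ, ‖T i x - x‖ ≤ (2 * D) * ((n : ℝ) + 1)⁻¹ := by
      intro n
      obtain ⟨z, hz, hzx⟩ := hx ⟨avg i n, Submonoid.subset_closure ⟨i, n, rfl⟩⟩
      have h1 : (T i - 1) * avg i n = ((n : ℝ) + 1)⁻¹ • (T i ^ (n + 1) - 1) := by
        rw [mul_smul_comm, mul_geom_sum]
      have h2 : T i x - x = ((n : ℝ) + 1)⁻¹ • ((T i ^ (n + 1)) z - z) := by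
        have := congrArg (fun S : E →L[ℝ] E => S z) h1
        simp only [hmul, _root_.sub_apply, _root_.smul_apply] at this
        rw [← hzx]
        exact this
      rw [h2, norm_smul, Real.norm_of_nonneg (by positivity), mul_comm]
      refine mul_le_mul_of_nonneg_right ?_ (by positivity)
      refine (norm_sub_le _ _).trans ?_
      linarith [hD _ (hpow i (n + 1) hz), hD _ hz]
    have hlim : Tendsto (fun n : ℕ => (2 * D) * ((n : ℝ) + 1)⁻¹) atTop (𝓝 0) := by
      simpa only [one_div, mul_zero] using
        (tendsto_one_div_add_atTop_nhds_zero_nat (𝕜 := ℝ)).const_mul (2 * D)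
    have h0 : ‖T i x - x‖ ≤ 0 := ge_of_tendsto' hlim hbound
    exact sub_eq_zero.1 (norm_le_zero_iff.1 h0)

/-! ### Eigenvectors and compact orbits of unitary representations -/

section UnitaryRep

variable {G : Type*} {H : Type*} [NormedAddCommGroup H] [InnerProductSpace ℂ H]

/-- The joint eigenspace of a unitary representation, for a function `χ` on the group. -/
def jointEigenspace [Group G] (U : G →* (H ≃ₗᵢ[ℂ] H)) (χ : G → ℂ) : Submodule ℂ H where
  carrier := {x | ∀ g, U g x = χ g • x}
  add_mem' hx hy g := by rw [map_add, hx g, hy g, smul_add]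
  zero_mem' g := by rw [map_zero, smul_zero]
  smul_mem' c x hx g := by rw [map_smul, hx g, smul_comm]

/-- The closed linear span of the joint eigenvectors of a unitary representation. -/
noncomputable def eigenvectorSpan [Group G] (U : G →* (H ≃ₗᵢ[ℂ] H)) : Submodule ℂ H :=
  (⨆ χ, jointEigenspace U χ).topologicalClosure

theorem isClosed_eigenvectorSpan [Group G] (U : G →* (H ≃ₗᵢ[ℂ] H)) :
    IsClosed (eigenvectorSpan U : Set H) := Submodule.isClosed_topologicalClosure _

theorem jointEigenspace_le_eigenvectorSpan [Group G] (U : G →* (H ≃ₗᵢ[ℂ] H)) (χ : G → ℂ) :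
    jointEigenspace U χ ≤ eigenvectorSpan U :=
  (le_iSup _ χ).trans (Submodule.le_topologicalClosure _)

theorem isClosed_jointEigenspace [Group G] (U : G →* (H ≃ₗᵢ[ℂ] H)) (χ : G → ℂ) :
    IsClosed (jointEigenspace U χ : Set H) := by
  have : (jointEigenspace U χ : Set H) = ⋂ g, {x | U g x = χ g • x} := by
    ext x
    simp [jointEigenspace]
  rw [this]
  exact isClosed_iInter fun g => isClosed_eq (U g).continuous (continuous_const_smul _)

theorem unitaryRep_mul_apply [Group G] (U : G →* (H ≃ₗᵢ[ℂ] H)) (g h : G) (x : H) :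
    U (g * h) x = U g (U h x) := by
  rw [map_mul]
  rfl

theorem unitaryRep_one_apply [Group G] (U : G →* (H ≃ₗᵢ[ℂ] H)) (x : H) : U 1 x = x := by
  rw [map_one]
  rfl

theorem unitaryRep_mem_eigenvectorSpan [Group G] (U : G →* (H ≃ₗᵢ[ℂ] H)) (g : G) {x : H}
    (hx : x ∈ eigenvectorSpan U) : U g x ∈ eigenvectorSpan U := by
  have h1 : (⨆ χ, jointEigenspace U χ) ≤
      (⨆ χ, jointEigenspace U χ).comap ((U g).toLinearEquiv : H →ₗ[ℂ] H) := by
    refine iSup_le fun χ y hy => ?_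
    change U g y ∈ ⨆ χ, jointEigenspace U χ
    rw [hy g]
    exact Submodule.smul_mem _ _ (Submodule.mem_iSup_of_mem χ hy)
  exact map_mem_closure (U g).continuous hx h1

theorem inner_unitaryRep_right [Group G] (U : G →* (H ≃ₗᵢ[ℂ] H)) (g : G) (x y : H) :
    ⟪x, U g y⟫_ℂ = ⟪U g⁻¹ x, y⟫_ℂ := by
  rw [← (U g⁻¹).inner_map_map x (U g y), ← unitaryRep_mul_apply, inv_mul_cancel,
    unitaryRep_one_apply]

theorem unitaryRep_mem_eigenvectorSpan_orthogonal [Group G] (U : G →* (H ≃ₗᵢ[ℂ] H)) (g : G) {x : H}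
    (hx : x ∈ (eigenvectorSpan U)ᗮ) : U g x ∈ (eigenvectorSpan U)ᗮ := by
  intro y hy
  rw [inner_unitaryRep_right]
  exact hx _ (unitaryRep_mem_eigenvectorSpan U _ hy)

/-- The eigenvalue of a joint eigenvector is a character of the group. -/
theorem exists_character_of_eigenvector [Group G] (U : G →* (H ≃ₗᵢ[ℂ] H)) {χ : G → ℂ} {x : H}
    (hx : x ∈ jointEigenspace U χ) (hx0 : x ≠ 0) : ∃ ψ : G →* Circle, ∀ g, χ g = ψ g := by
  have h1 : χ 1 = 1 := by
    have := hx 1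
    rw [unitaryRep_one_apply] at this
    have h2 : (χ 1 - 1) • x = 0 := by rw [sub_smul, ← this, one_smul, sub_self]
    exact sub_eq_zero.1 ((smul_eq_zero.1 h2).resolve_right hx0)
  have hmul : ∀ g h, χ (g * h) = χ g * χ h := by
    intro g h
    have h1 := hx (g * h)
    rw [unitaryRep_mul_apply, hx h, map_smul, hx g, smul_smul] at h1
    have h2 : (χ (g * h) - χ g * χ h) • x = 0 := by rw [sub_smul, ← h1, mul_comm, sub_self]
    exact sub_eq_zero.1 ((smul_eq_zero.1 h2).resolve_right hx0)
  have hnorm : ∀ g, ‖χ g‖ = 1 := by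
    intro g
    have h1 : ‖χ g • x‖ = ‖x‖ := by rw [← hx g, LinearIsometryEquiv.norm_map]
    rw [norm_smul] at h1
    exact mul_right_cancel₀ (norm_ne_zero_iff.2 hx0) (h1.trans (one_mul _).symm)
  exact ⟨{ toFun := fun g => ⟨χ g, mem_sphere_zero_iff_norm.2 (hnorm g)⟩
           map_one' := Circle.ext h1
           map_mul' := fun g h => Circle.ext (hmul g h) }, fun g => rfl⟩

/-- The orbit of an eigenvector lies on a circle, so that the orbits of linear combinations of
eigenvectors are totally bounded, and this passes to limits. -/
theorem totallyBounded_orbit_of_mem_eigenvectorSpan [CompleteSpace H] [Group G]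
    (U : G →* (H ≃ₗᵢ[ℂ] H)) {x : H} (hx : x ∈ eigenvectorSpan U) :
    TotallyBounded (Set.range fun g => U g x) := by
  have hadd : ∀ x y : H, TotallyBounded (Set.range fun g => U g x) →
      TotallyBounded (Set.range fun g => U g y) →
      TotallyBounded (Set.range fun g => U g (x + y)) := by
    intro x y h1 h2
    have h3 := (h1.closure.isCompact_of_isClosed isClosed_closure).prod
      (h2.closure.isCompact_of_isClosed isClosed_closure)
    refine (h3.image continuous_add).totallyBounded.subset ?_
    rintro _ ⟨g, rfl⟩
    exact ⟨(U g x, U g y), ⟨subset_closure ⟨g, rfl⟩, subset_closure ⟨g, rfl⟩⟩,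
      (map_add _ _ _).symm⟩
  have heig : ∀ y ∈ ⨆ χ, jointEigenspace U χ, TotallyBounded (Set.range fun g => U g y) := by
    intro y hy
    induction hy using Submodule.iSup_induction' with
    | mem χ y hy =>
      by_cases hy0 : y = 0
      · subst hy0
        simp only [map_zero]
        exact (Set.finite_range_const).totallyBounded
      · obtain ⟨ψ, hψ⟩ := exists_character_of_eigenvector U hy hy0
        refine (((isCompact_sphere (0 : ℂ) 1).image
          (f := fun c : ℂ => c • y) (by fun_prop)).totallyBounded).subset ?_
        rintro _ ⟨g, rfl⟩
        exact ⟨ψ g, (ψ g).2, by rw [← hψ]; exact (hy g).symm⟩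
    | zero =>
      simp only [map_zero]
      exact (Set.finite_range_const).totallyBounded
    | add y z _ _ h1 h2 => exact hadd y z h1 h2
  rw [Metric.totallyBounded_iff]
  intro ε hε
  obtain ⟨y, hy, hxy⟩ := Metric.mem_closure_iff.1 (show x ∈ closure _ from hx) (ε / 2) (half_pos hε)
  obtain ⟨t, ht, hcov⟩ := Metric.totallyBounded_iff.1 (heig y hy) (ε / 2) (half_pos hε)
  refine ⟨t, ht, ?_⟩
  rintro _ ⟨g, rfl⟩
  obtain ⟨z, hz, hd⟩ := Set.mem_iUnion₂.1 (hcov ⟨g, rfl⟩)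
  refine Set.mem_iUnion₂.2 ⟨z, hz, ?_⟩
  rw [Metric.mem_ball] at hd ⊢
  calc dist (U g x) z ≤ dist (U g x) (U g y) + dist (U g y) z := dist_triangle _ _ _
    _ < ε / 2 + ε / 2 := by rw [(U g).dist_map]; exact add_lt_add hxy hd
    _ = ε := add_halves ε

/-- Commuting unitaries have a common eigenvector in each nonzero finite-dimensional invariant
subspace. -/
theorem exists_jointEigenspace_mem_of_finiteDimensional [CommGroup G] (U : G →* (H ≃ₗᵢ[ℂ] H))
    (W : Submodule ℂ H) [FiniteDimensional ℂ W] (hW : W ≠ ⊥) (hinv : ∀ g, ∀ x ∈ W, U g x ∈ W) :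
    ∃ x ∈ W, x ≠ 0 ∧ ∃ χ, x ∈ jointEigenspace U χ := by
  induction hn : Module.finrank ℂ W using Nat.strong_induction_on generalizing W with
  | _ n ih =>
  by_cases hs : ∀ g, ∃ c : ℂ, ∀ x ∈ W, U g x = c • x
  · choose χ hχ using hs
    obtain ⟨x, hx, hx0⟩ := Submodule.exists_mem_ne_zero_of_ne_bot hW
    exact ⟨x, hx, hx0, χ, fun g => hχ g x hx⟩
  · push Not at hs
    obtain ⟨g, hg⟩ := hs
    have : Nontrivial W := Submodule.nontrivial_iff_ne_bot.2 hW
    obtain ⟨c, hc⟩ := Module.End.exists_eigenvalue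
      (((U g).toLinearEquiv : H →ₗ[ℂ] H).restrict (hinv g))
    obtain ⟨v, hv⟩ := hc.exists_hasEigenvector
    let E : Submodule ℂ H := LinearMap.ker (((U g).toLinearEquiv : H →ₗ[ℂ] H) - c • LinearMap.id)
    have hE : ∀ y, y ∈ E ↔ U g y = c • y := fun y => by
      rw [LinearMap.mem_ker, LinearMap.sub_apply, sub_eq_zero]
      rfl
    have hlt : W ⊓ E < W := by
      refine lt_of_le_of_ne inf_le_left fun h => ?_
      obtain ⟨x, hx, hne⟩ := hg c
      rw [← h] at hx
      exact hne ((hE x).1 hx.2)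
    have hfd : FiniteDimensional ℂ (W ⊓ E : Submodule ℂ H) :=
      Submodule.finiteDimensional_of_le inf_le_left
    obtain ⟨x, hx, hx0, χ, hχ⟩ := ih _ (hn ▸ Submodule.finrank_lt_finrank_of_lt hlt) (W ⊓ E) (by
      rw [Submodule.ne_bot_iff]
      refine ⟨v, ⟨v.2, (hE _).2 ?_⟩, fun h => hv.2 (Subtype.ext h)⟩
      exact congrArg Subtype.val hv.apply_eq_smul) (by
      intro h x hx
      refine ⟨hinv h x hx.1, (hE _).2 ?_⟩
      rw [← unitaryRep_mul_apply, mul_comm, unitaryRep_mul_apply, (hE x).1 hx.2, map_smul]) rfl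
    exact ⟨x, hx.1, hx0, χ, hχ⟩

/-- A unitary representation of an abelian group has no nonzero vector with totally bounded orbit
in the orthogonal complement of its eigenvectors. Averaging the rank one operators
`z ↦ ⟪U g x, z⟫ • U g x` by the Markov–Kakutani theorem gives a nonzero compact operator which
commutes with the representation; an eigenspace of it contains joint eigenvectors. -/
theorem eq_zero_of_totallyBounded_orbit [CompleteSpace H] [CommGroup G] (U : G →* (H ≃ₗᵢ[ℂ] H))
    {x : H} (hx : x ∈ (eigenvectorSpan U)ᗮ) (htb : TotallyBounded (Set.range fun g => U g x)) :
    x = 0 := by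
  by_contra hx0
  let p : H → H →L[ℂ] H := fun y => InnerProductSpace.rankOne ℂ y y
  have hp : Continuous p := by
    exact (ContinuousLinearMap.smulRightL ℂ H H).continuous₂.comp
      ((innerSL ℂ (E := H)).continuous.prodMk continuous_id)
  let D : Set (H →L[ℂ] H) := Set.range fun g => p (U g x)
  let C : Set (H →L[ℂ] H) := closure (convexHull ℝ D)
  have hD : TotallyBounded D := by
    have hcomp : IsCompact (closure (Set.range fun g => U g x)) :=
      htb.closure.isCompact_of_isClosed isClosed_closure
    refine (hcomp.image hp).totallyBounded.subset ?_
    rintro _ ⟨g, rfl⟩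
    exact ⟨_, subset_closure ⟨g, rfl⟩, rfl⟩
  have hC : IsCompact C :=
    hD.convexHull.closure.isCompact_of_isClosed isClosed_closure
  have hCD : ∀ s : Set (H →L[ℂ] H), IsClosed s → Convex ℝ s → (∀ g, p (U g x) ∈ s) → C ⊆ s := by
    intro s h1 h2 h3
    refine closure_minimal (convexHull_min ?_ h2) h1
    rintro _ ⟨g, rfl⟩
    exact h3 g
  let V : G → H →L[ℂ] H := fun g => ((U g).toContinuousLinearEquiv : H →L[ℂ] H)
  have hV : ∀ g h, V (g * h) = V g * V h := fun g h => by
    ext y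
    exact unitaryRep_mul_apply U g h y
  let T : G → (H →L[ℂ] H) →L[ℝ] (H →L[ℂ] H) := fun g =>
    ((ContinuousLinearMap.mul ℝ (H →L[ℂ] H) (V g))).comp
      ((ContinuousLinearMap.mul ℝ (H →L[ℂ] H)).flip (V g⁻¹))
  have hTa : ∀ g B, T g B = V g * (B * V g⁻¹) := fun g B => rfl
  have hTp : ∀ g h, T g (p (U h x)) = p (U (g * h) x) := by
    intro g h
    ext y
    rw [hTa, unitaryRep_mul_apply]
    change U g (⟪U h x, U g⁻¹ y⟫_ℂ • U h x) = ⟪U g (U h x), y⟫_ℂ • U g (U h x)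
    rw [map_smul, inner_unitaryRep_right, inv_inv]
  obtain ⟨B, hB, hfix⟩ := exists_forall_map_eq_of_commute hC (convex_convexHull ℝ D).closure
    ⟨_, subset_closure (subset_convexHull ℝ D ⟨1, rfl⟩)⟩ T (fun g h => by
      ext1 B
      change T g (T h B) = T h (T g B)
      simp only [hTa]
      have h1 : V g * V h = V h * V g := by rw [← hV, mul_comm, hV]
      have h2 : V h⁻¹ * V g⁻¹ = V g⁻¹ * V h⁻¹ := by rw [← hV, mul_comm, hV]
      calc V g * (V h * (B * V h⁻¹) * V g⁻¹) = (V g * V h) * B * (V h⁻¹ * V g⁻¹) := by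
            simp only [mul_assoc]
        _ = _ := by rw [h1, h2]; simp only [mul_assoc]) (fun g => by
      refine Set.MapsTo.closure ?_ (T g).continuous
      rw [Set.mapsTo_iff_image_subset, ← ContinuousLinearMap.coe_coe, LinearMap.image_convexHull]
      refine convexHull_mono ?_
      rintro _ ⟨_, ⟨h, rfl⟩, rfl⟩
      exact ⟨g * h, (hTp g h).symm⟩)
  have hcpt : IsCompactOperator B := by
    have := hCD (compactOperator (RingHom.id ℂ) H H) isClosed_setOfPred_isCompactOperator
      (Submodule.convex ((compactOperator (RingHom.id ℂ) H H).restrictScalars ℝ)) (fun g => by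
        have h1 : IsCompactOperator (innerSL ℂ (U g x)) :=
          isCompactOperator_of_locallyCompactSpace_dom _
        exact h1.clm_comp (ContinuousLinearMap.toSpanSingleton ℂ (U g x)))
    exact this hB
  have hsa : IsSelfAdjoint B := by
    refine hCD {B | IsSelfAdjoint B} (isClosed_eq continuous_star continuous_id)
      (fun S hS S' hS' a b _ _ _ => ?_) (fun g => ?_) hB
    · exact (isSelfAdjoint_real_smul _ hS).add (isSelfAdjoint_real_smul _ hS')
    · exact InnerProductSpace.adjoint_rankOne _ _
  have hran : ∀ z, B z ∈ (eigenvectorSpan U)ᗮ := by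
    intro z
    refine hCD {B | B z ∈ (eigenvectorSpan U)ᗮ}
      ((Submodule.isClosed_orthogonal _).preimage (ContinuousLinearMap.apply ℂ H z).continuous)
      (fun S hS S' hS' a b _ _ _ => ?_) (fun g => ?_) hB
    · exact Submodule.add_mem _ (((eigenvectorSpan U)ᗮ.restrictScalars ℝ).smul_mem a hS)
        (((eigenvectorSpan U)ᗮ.restrictScalars ℝ).smul_mem b hS')
    · exact Submodule.smul_mem _ _ (unitaryRep_mem_eigenvectorSpan_orthogonal U g hx)
  have hcommB : ∀ g z, B (U g z) = U g (B z) := by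
    intro g z
    have h1 := congrArg (fun S : H →L[ℂ] H => S (U g z)) (hfix g)
    change U g (B (U g⁻¹ (U g z))) = B (U g z) at h1
    rw [← unitaryRep_mul_apply, inv_mul_cancel, unitaryRep_one_apply] at h1
    exact h1.symm
  have hB0 : B ≠ 0 := by
    -- a finite net of the orbit bounds the trace of the averages from below
    have hxpos : 0 < ‖x‖ := norm_pos_iff.2 hx0
    obtain ⟨t, ht, hcov⟩ := Metric.totallyBounded_iff.1 htb (‖x‖ / 2) (half_pos hxpos)
    let φ : (H →L[ℂ] H) → ℝ := fun S => ∑ y ∈ ht.toFinset, RCLike.re ⟪y, S y⟫_ℂ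
    have hφ : (‖x‖ ^ 2 / 2) ^ 2 ≤ φ B := by
      refine hCD {S | (‖x‖ ^ 2 / 2) ^ 2 ≤ φ S} ?_ ?_ ?_ hB
      · refine isClosed_le continuous_const (continuous_finsetSum _ fun y _ => ?_)
        exact RCLike.continuous_re.comp (continuous_const.inner
          (ContinuousLinearMap.apply ℂ H y).continuous)
      · intro S hS S' hS' a b ha hb hab
        have hlin : φ (a • S + b • S') = a * φ S + b * φ S' := by
          simp only [φ, Finset.mul_sum, ← Finset.sum_add_distrib]
          refine Finset.sum_congr rfl fun y _ => ?_
          rw [_root_.add_apply, _root_.smul_apply, _root_.smul_apply, inner_add_right, map_add,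
            ← Complex.coe_smul, ← Complex.coe_smul, inner_smul_right, inner_smul_right]
          simp
        rw [Set.mem_ofPred_eq] at hS hS' ⊢
        rw [hlin]
        calc (‖x‖ ^ 2 / 2) ^ 2 = a * (‖x‖ ^ 2 / 2) ^ 2 + b * (‖x‖ ^ 2 / 2) ^ 2 := by
              rw [← add_mul, hab, one_mul]
          _ ≤ _ := add_le_add (mul_le_mul_of_nonneg_left hS ha) (mul_le_mul_of_nonneg_left hS' hb)
      · intro g
        have hterm : ∀ y, RCLike.re ⟪y, p (U g x) y⟫_ℂ = ‖⟪y, U g x⟫_ℂ‖ ^ 2 := by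
          intro y
          change RCLike.re ⟪y, ⟪U g x, y⟫_ℂ • U g x⟫_ℂ = _
          rw [inner_smul_right, ← inner_conj_symm, RCLike.conj_mul]
          norm_cast
        obtain ⟨y, hy, hd⟩ := Set.mem_iUnion₂.1 (hcov ⟨g, rfl⟩)
        change _ ≤ φ _
        simp only [φ, hterm]
        refine le_trans ?_ (Finset.single_le_sum (f := fun y => ‖⟪y, U g x⟫_ℂ‖ ^ 2)
          (fun _ _ => by positivity) (ht.mem_toFinset.2 hy))
        refine pow_le_pow_left₀ (by positivity) ?_ 2
        rw [Metric.mem_ball, dist_comm, dist_eq_norm] at hd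
        have h1 : ⟪U g x, U g x⟫_ℂ = ⟪y, U g x⟫_ℂ - ⟪y - U g x, U g x⟫_ℂ := by
          rw [inner_sub_left, sub_sub_cancel]
        have h2 : ‖⟪U g x, U g x⟫_ℂ‖ = ‖x‖ ^ 2 := by
          rw [(U g).inner_map_map, inner_self_eq_norm_sq_to_K]
          simp
        have h3 : ‖⟪y - U g x, U g x⟫_ℂ‖ ≤ ‖x‖ / 2 * ‖x‖ := by
          refine (norm_inner_le_norm _ _).trans ?_
          rw [(U g).norm_map]
          exact mul_le_mul_of_nonneg_right hd.le (norm_nonneg _)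
        have h4 : ‖x‖ ^ 2 ≤ ‖⟪y, U g x⟫_ℂ‖ + ‖⟪y - U g x, U g x⟫_ℂ‖ := by
          rw [← h2, h1]
          exact norm_sub_le _ _
        nlinarith
    intro h0
    rw [h0] at hφ
    simp only [φ, _root_.zero_apply, inner_zero_right, map_zero, Finset.sum_const_zero] at hφ
    have : 0 < (‖x‖ ^ 2 / 2) ^ 2 := by positivity
    linarith
  obtain ⟨c, hc, hc0⟩ : ∃ c, Module.End.HasEigenvalue (B : Module.End ℂ H) c ∧ c ≠ 0 := by
    by_contra hcon
    push Not at hcon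
    exact hB0 ((ContinuousLinearMap.eq_zero_of_forall_hasEigenvalue_eq_zero hcpt
      hsa.isSymmetric).1 hcon)
  have hfd := ContinuousLinearMap.finite_dimensional_eigenspace hcpt c hc0
  obtain ⟨e, he, he0, χ, hχ⟩ := exists_jointEigenspace_mem_of_finiteDimensional U
    (Module.End.eigenspace (B : Module.End ℂ H) c) hc (fun g z hz => by
      rw [Module.End.mem_eigenspace_iff] at hz ⊢
      change B (U g z) = c • U g z
      change B z = c • z at hz
      rw [hcommB, hz, map_smul])
  rw [Module.End.mem_eigenspace_iff] at he
  change B e = c • e at he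
  have he1 : e ∈ (eigenvectorSpan U)ᗮ := by
    have : e = c⁻¹ • B e := by rw [he, smul_smul, inv_mul_cancel₀ hc0, one_smul]
    rw [this]
    exact Submodule.smul_mem _ _ (hran e)
  exact he0 (inner_self_eq_zero.1 (he1 e (jointEigenspace_le_eigenvectorSpan U χ hχ)))

/-- For a unitary representation of an abelian group, a vector with totally bounded orbit is a limit
of linear combinations of eigenvectors. -/
theorem mem_eigenvectorSpan_of_totallyBounded_orbit [CompleteSpace H] [CommGroup G]
    (U : G →* (H ≃ₗᵢ[ℂ] H)) {x : H} (htb : TotallyBounded (Set.range fun g => U g x)) :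
    x ∈ eigenvectorSpan U := by
  have : CompleteSpace (eigenvectorSpan U) := (isClosed_eigenvectorSpan U).completeSpace_coe
  let P := (eigenvectorSpan U).starProjection
  have hP : ∀ g, U g (x - P x) = U g x - P (U g x) := by
    intro g
    have : P (U g x) = U g (P x) := by
      refine Submodule.eq_starProjection_of_mem_orthogonal
        (unitaryRep_mem_eigenvectorSpan U g (Submodule.starProjection_apply_mem _ _)) ?_
      rw [← map_sub]
      exact unitaryRep_mem_eigenvectorSpan_orthogonal U g
        (Submodule.sub_starProjection_mem_orthogonal _)
    rw [map_sub, this]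
  have h0 : x - P x = 0 := by
    refine eq_zero_of_totallyBounded_orbit U (Submodule.sub_starProjection_mem_orthogonal _) ?_
    refine (htb.image (f := fun y => y - P y)
      (uniformContinuous_id.sub P.uniformContinuous)).subset ?_
    rintro _ ⟨g, rfl⟩
    exact ⟨_, ⟨g, rfl⟩, (hP g).symm⟩
  rw [sub_eq_zero.1 h0]
  exact Submodule.starProjection_apply_mem _ _

end UnitaryRep

/-! ### Følner sets in abelian groups -/

/-- Boxes `{∏ s ^ m s : 0 ≤ m s ≤ N}` are Følner sets in an abelian group for infinitely many `N`,
since their cardinality grows polynomially in `N`. -/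
theorem exists_folner_finset {Γ : Type*} [CommGroup Γ] [DecidableEq Γ] (S : Finset Γ) {ε : ℝ}
    (hε : 0 < ε) :
    ∃ F : Finset Γ, F.Nonempty ∧
      ∀ s ∈ S, (1 - ε) * F.card ≤ (F.filter fun x => s * x ∈ F).card := by
  by_contra hcon
  push Not at hcon
  let F : ℕ → Finset Γ := fun N => (Fintype.piFinset fun _ : S => Finset.range (N + 1)).image
    fun m => ∏ s : S, (s : Γ) ^ m s
  have hF : ∀ N, (F N).Nonempty := fun N =>
    (Fintype.piFinset_nonempty.2 fun _ => Finset.nonempty_range_add_one).image _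
  have hcard : ∀ N, (F N).card ≤ (N + 1) ^ S.card := by
    intro N
    refine Finset.card_image_le.trans ?_
    simp [Fintype.card_piFinset]
  have hmono : ∀ N, F N ⊆ F (N + 1) := by
    intro N
    refine Finset.image_subset_image (Fintype.piFinset_subset _ _ fun _ => ?_)
    exact Finset.range_mono (by omega)
  have hmul : ∀ N, ∀ s ∈ S, ∀ x ∈ F N, s * x ∈ F (N + 1) := by
    intro N s hs x hx
    obtain ⟨m, hm, rfl⟩ := Finset.mem_image.1 hx
    refine Finset.mem_image.2 ⟨fun t => m t + if t = ⟨s, hs⟩ then 1 else 0, ?_, ?_⟩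
    · rw [Fintype.mem_piFinset] at hm ⊢
      intro t
      have := Finset.mem_range.1 (hm t)
      rw [Finset.mem_range]
      split_ifs <;> omega
    · simp only [pow_add, Finset.prod_mul_distrib, pow_ite, pow_one, pow_zero,
        Finset.prod_ite_eq', Finset.mem_univ, if_true]
      exact mul_comm _ _
  have hgrow : ∀ N, (1 + ε) * (F N).card ≤ (F (N + 1)).card := by
    intro N
    obtain ⟨s, hs, hlt⟩ := hcon (F N) (hF N)
    have hsub : F N ∪ ((F N).filter fun x => ¬ s * x ∈ F N).image (s * ·) ⊆ F (N + 1) := by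
      refine Finset.union_subset (hmono N) ?_
      intro y hy
      obtain ⟨x, hx, rfl⟩ := Finset.mem_image.1 hy
      exact hmul N s hs x (Finset.mem_filter.1 hx).1
    have hdisj : Disjoint (F N) (((F N).filter fun x => ¬ s * x ∈ F N).image (s * ·)) := by
      rw [Finset.disjoint_right]
      intro y hy
      obtain ⟨x, hx, rfl⟩ := Finset.mem_image.1 hy
      exact (Finset.mem_filter.1 hx).2
    have h1 := Finset.card_le_card hsub
    rw [Finset.card_union_of_disjoint hdisj,
      Finset.card_image_of_injective _ (mul_right_injective s)] at h1
    have h2 := Finset.card_filter_add_card_filter_not (s := F N) (fun x => s * x ∈ F N)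
    have h1' : ((F N).card : ℝ) + ((F N).filter fun x => ¬ s * x ∈ F N).card ≤
        (F (N + 1)).card := by
      exact_mod_cast h1
    have h2' : (((F N).filter fun x => s * x ∈ F N).card : ℝ) +
        ((F N).filter fun x => ¬ s * x ∈ F N).card = (F N).card := by
      exact_mod_cast h2
    linarith
  have hexp : ∀ N, (1 + ε) ^ N ≤ (F N).card := by
    intro N
    induction N with
    | zero =>
      rw [pow_zero]
      exact_mod_cast (hF 0).card_pos
    | succ N ih =>
      rw [pow_succ, mul_comm]
      exact (mul_le_mul_of_nonneg_left ih (by linarith)).trans (hgrow N)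
  have hlim := (tendsto_pow_const_div_const_pow_of_one_lt S.card
    (show (1 : ℝ) < 1 + ε by linarith)).comp (tendsto_add_atTop_nat 1)
  have hle : (1 + ε)⁻¹ ≤ 0 := by
    refine ge_of_tendsto' hlim fun N => ?_
    have h1 : (1 + ε) ^ N ≤ ((N : ℝ) + 1) ^ S.card := (hexp N).trans (by exact_mod_cast hcard N)
    simp only [Function.comp, Nat.cast_add, Nat.cast_one]
    rw [inv_eq_one_div, div_le_div_iff₀ (by linarith) (by positivity), one_mul, pow_succ]
    exact mul_le_mul_of_nonneg_right h1 (by linarith)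
  have : 0 < (1 + ε)⁻¹ := by positivity
  linarith

/-! ### The mean ergodic theorem for unitary representations -/

section MeanErgodic

variable {G : Type*} [Group G] {H : Type*} [NormedAddCommGroup H] [InnerProductSpace ℂ H]

/-- The vector of least norm in a closed convex set is fixed by all norm preserving maps of the set
into itself. -/
theorem exists_forall_norm_preserving_fixed {E : Type*} [NormedAddCommGroup E]
    [InnerProductSpace ℝ E] [CompleteSpace E] {C : Set E} (hne : C.Nonempty) (hC : IsClosed C)
    (hconv : Convex ℝ C) :
    ∃ z ∈ C, ∀ f : E → E, (∀ x, ‖f x‖ = ‖x‖) → Set.MapsTo f C C → f z = z := by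
  obtain ⟨z, hz, hmin⟩ := exists_norm_eq_iInf_of_complete_convex hne hC.isComplete hconv 0
  have hle : ∀ y ∈ C, ‖z‖ ≤ ‖y‖ := by
    intro y hy
    have hbdd : BddBelow (Set.range fun w : C => ‖(0 : E) - w‖) :=
      ⟨0, by rintro _ ⟨w, rfl⟩; exact norm_nonneg _⟩
    have := ciInf_le hbdd ⟨y, hy⟩
    rw [← hmin] at this
    simpa using this
  refine ⟨z, hz, fun f hf hfC => eq_of_norm_eq_of_norm_add_eq (hf z) ?_⟩
  refine le_antisymm (norm_add_le _ _) ?_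
  have hmid : (1 / 2 : ℝ) • f z + (1 / 2 : ℝ) • z ∈ C :=
    hconv (hfC hz) hz (by norm_num) (by norm_num) (by norm_num)
  have h1 := hle _ hmid
  rw [← smul_add, norm_smul, Real.norm_of_nonneg (by norm_num)] at h1
  rw [hf]
  linarith

/-- The closed convex hull of an orbit contains a fixed vector. -/
theorem exists_fixed_mem_closure_convexHull_orbit [CompleteSpace H] (U : G →* (H ≃ₗᵢ[ℂ] H))
    (v : H) : ∃ z ∈ closure (convexHull ℝ (Set.range fun g => U g v)), ∀ g, U g z = z := by
  obtain ⟨z, hz, hfix⟩ := @exists_forall_norm_preserving_fixed H _ InnerProductSpace.complexToReal _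
    (closure (convexHull ℝ (Set.range fun g => U g v)))
    ⟨_, subset_closure (subset_convexHull ℝ _ ⟨1, rfl⟩)⟩ isClosed_closure
    (convex_convexHull ℝ _).closure
  refine ⟨z, hz, fun g => hfix (U g) (U g).norm_map ?_⟩
  refine Set.MapsTo.closure ?_ (U g).continuous
  rw [Set.mapsTo_iff_image_subset]
  have := LinearMap.image_convexHull (((U g).toLinearEquiv : H →ₗ[ℂ] H).restrictScalars ℝ)
    (Set.range fun g => U g v)
  refine this.trans_subset (convexHull_mono ?_)
  rintro _ ⟨_, ⟨h, rfl⟩, rfl⟩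
  exact ⟨g * h, unitaryRep_mul_apply U g h v⟩

/-- The unitary representation `g ↦ ψ(g)⁻¹ U_g`. -/
noncomputable def twistedRep (U : G →* (H ≃ₗᵢ[ℂ] H)) (ψ : G →* Circle) : G →* (H ≃ₗᵢ[ℂ] H) where
  toFun g :=
    { (((ψ g)⁻¹ : Circle) : ℂ) • ((U g).toLinearEquiv : H →ₗ[ℂ] H) with
      invFun := fun x => (ψ g : ℂ) • U g⁻¹ x
      left_inv := fun x => by
        change (ψ g : ℂ) • U g⁻¹ ((((ψ g)⁻¹ : Circle) : ℂ) • U g x) = x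
        rw [map_smul, smul_smul, ← Circle.coe_mul, mul_inv_cancel, Circle.coe_one, one_smul,
          ← unitaryRep_mul_apply, inv_mul_cancel, unitaryRep_one_apply]
      right_inv := fun x => by
        change (((ψ g)⁻¹ : Circle) : ℂ) • U g ((ψ g : ℂ) • U g⁻¹ x) = x
        rw [map_smul, smul_smul, ← Circle.coe_mul, inv_mul_cancel, Circle.coe_one, one_smul,
          ← unitaryRep_mul_apply, mul_inv_cancel, unitaryRep_one_apply]
      norm_map' := fun x => by
        change ‖(((ψ g)⁻¹ : Circle) : ℂ) • U g x‖ = ‖x‖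
        rw [norm_smul, Circle.norm_coe, one_mul, (U g).norm_map] }
  map_one' := by
    ext x
    change (((ψ 1)⁻¹ : Circle) : ℂ) • U 1 x = x
    rw [map_one, inv_one, Circle.coe_one, one_smul, unitaryRep_one_apply]
  map_mul' g h := by
    ext x
    change (((ψ (g * h))⁻¹ : Circle) : ℂ) • U (g * h) x =
      (((ψ g)⁻¹ : Circle) : ℂ) • U g ((((ψ h)⁻¹ : Circle) : ℂ) • U h x)
    rw [map_smul, smul_smul, ← Circle.coe_mul, ← mul_inv, ← map_mul, unitaryRep_mul_apply]

variable [CompleteSpace H]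

/-- The projection onto the joint eigenspace of a character. -/
noncomputable def eigenprojection (U : G →* (H ≃ₗᵢ[ℂ] H)) (ψ : G →* Circle) : H →L[ℂ] H :=
  have : CompleteSpace (jointEigenspace U fun g => ψ g) :=
    (isClosed_jointEigenspace U _).completeSpace_coe
  (jointEigenspace U fun g => ψ g).starProjection

theorem eigenprojection_mem (U : G →* (H ≃ₗᵢ[ℂ] H)) (ψ : G →* Circle) (x : H) :
    eigenprojection U ψ x ∈ jointEigenspace U fun g => ψ g :=
  have : CompleteSpace (jointEigenspace U fun g => ψ g) :=
    (isClosed_jointEigenspace U _).completeSpace_coe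
  Submodule.starProjection_apply_mem _ _

theorem eigenprojection_eq_of_forall_inner (U : G →* (H ≃ₗᵢ[ℂ] H)) (ψ : G →* Circle) {x z : H}
    (hz : z ∈ jointEigenspace U fun g => ψ g)
    (h : ∀ y ∈ jointEigenspace U fun g => ψ g, ⟪y, z⟫_ℂ = ⟪y, x⟫_ℂ) :
    eigenprojection U ψ x = z := by
  have : CompleteSpace (jointEigenspace U fun g => ψ g) :=
    (isClosed_jointEigenspace U _).completeSpace_coe
  refine Submodule.eq_starProjection_of_mem_orthogonal hz fun y hy => ?_
  rw [inner_sub_right, h y hy, sub_self]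

theorem eigenprojection_apply_of_mem [DecidableEq (G →* Circle)] (U : G →* (H ≃ₗᵢ[ℂ] H))
    (ψ φ : G →* Circle) {y : H} (hy : y ∈ jointEigenspace U fun g => φ g) :
    eigenprojection U ψ y = if ψ = φ then y else 0 := by
  split_ifs with h
  · subst h
    exact eigenprojection_eq_of_forall_inner U ψ hy fun _ _ => rfl
  · refine eigenprojection_eq_of_forall_inner U ψ (Submodule.zero_mem _) fun x hx => ?_
    rw [inner_zero_right]
    by_contra hne
    refine h (MonoidHom.ext fun g => Circle.ext ?_)
    have h1 := (U g).inner_map_map x y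
    rw [hx g, hy g, inner_smul_left, inner_smul_right, ← mul_assoc] at h1
    have h2 : (starRingEnd ℂ) (ψ g : ℂ) * φ g = 1 :=
      mul_right_cancel₀ (Ne.symm hne) (h1.trans (one_mul _).symm)
    have h3 : (ψ g : ℂ) * (starRingEnd ℂ) (ψ g : ℂ) = 1 := by
      rw [Complex.mul_conj, Circle.normSq_coe, Complex.ofReal_one]
    calc (ψ g : ℂ) = ψ g * ((starRingEnd ℂ) (ψ g : ℂ) * φ g) := by rw [h2, mul_one]
      _ = φ g := by rw [← mul_assoc, h3, one_mul]

/-- Finitely many projections onto joint eigenspaces are approximated simultaneously by averages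
over the group, with the same weights. -/
theorem exists_weights_near_eigenprojection (U : G →* (H ≃ₗᵢ[ℂ] H)) {ι : Type*} [Fintype ι]
    (ψ : ι → G →* Circle) (v : ι → H) {ε : ℝ} (hε : 0 < ε) :
    ∃ (κ : Type) (t : Finset κ) (w : κ → ℝ) (γ : κ → G), (∀ k ∈ t, 0 ≤ w k) ∧ ∑ k ∈ t, w k = 1 ∧
      ∀ i, ‖∑ k ∈ t, w k • (((ψ i (γ k))⁻¹ : Circle) : ℂ) • U (γ k) (v i) -
        eigenprojection U (ψ i) (v i)‖ < ε := by
  let V : G →* ((PiLp 2 fun _ : ι => H) ≃ₗᵢ[ℂ] (PiLp 2 fun _ : ι => H)) :=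
    { toFun := fun g => LinearIsometryEquiv.piLpCongrRight 2 fun i => twistedRep U (ψ i) g
      map_one' := by
        ext x i
        change twistedRep U (ψ i) 1 (x i) = x i
        exact unitaryRep_one_apply _ _
      map_mul' := fun g h => by
        ext x i
        exact unitaryRep_mul_apply (twistedRep U (ψ i)) g h (x i) }
  have hV : ∀ g x i, V g x i = (((ψ i g)⁻¹ : Circle) : ℂ) • U g (x i) := fun g x i => rfl
  obtain ⟨z, hz, hfix⟩ := exists_fixed_mem_closure_convexHull_orbit V (WithLp.toLp 2 v)
  have hzP : ∀ i, eigenprojection U (ψ i) (v i) = z i := by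
    intro i
    refine eigenprojection_eq_of_forall_inner U (ψ i) ?_ fun y hy => ?_
    · intro g
      have h1 : (((ψ i g)⁻¹ : Circle) : ℂ) • U g (z i) = z i := by rw [← hV, hfix]
      conv_rhs => rw [← h1]
      rw [smul_smul, ← Circle.coe_mul, mul_inv_cancel, Circle.coe_one, one_smul]
    · have hy' : ∀ g, ⟪y, (((ψ i g)⁻¹ : Circle) : ℂ) • U g (v i)⟫_ℂ = ⟪y, v i⟫_ℂ := by
        intro g
        have h1 : U g⁻¹ y = (((ψ i g)⁻¹ : Circle) : ℂ) • y := by rw [← map_inv]; exact hy g⁻¹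
        rw [inner_smul_right, inner_unitaryRep_right, h1, inner_smul_left, ← mul_assoc,
          Complex.mul_conj, Circle.normSq_coe, Complex.ofReal_one, one_mul]
      let s : Set (PiLp 2 fun _ : ι => H) := {x | ⟪y, x i⟫_ℂ = ⟪y, v i⟫_ℂ}
      have hsc : IsClosed s :=
        isClosed_eq (continuous_const.inner (PiLp.continuous_apply 2 _ i)) continuous_const
      have hsconv : Convex ℝ s := by
        intro x hx x' hx' a b _ _ hab
        change ⟪y, a • x i + b • x' i⟫_ℂ = _
        rw [inner_add_right, ← Complex.coe_smul, ← Complex.coe_smul, inner_smul_right,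
          inner_smul_right, show ⟪y, x i⟫_ℂ = _ from hx, show ⟪y, x' i⟫_ℂ = _ from hx', ← add_mul,
          ← Complex.ofReal_add, hab, Complex.ofReal_one, one_mul]
      have hsub : closure (convexHull ℝ (Set.range fun g => V g (WithLp.toLp 2 v))) ⊆ s := by
        refine closure_minimal (convexHull_min ?_ hsconv) hsc
        rintro _ ⟨g, rfl⟩
        exact hy' g
      exact hsub hz
  obtain ⟨z', hz', hd⟩ := Metric.mem_closure_iff.1 hz ε hε
  rw [convexHull_eq] at hz'
  obtain ⟨κ, t, w, f, hw, hw1, hf, rfl⟩ := hz'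
  have hf' : ∀ k, ∃ g, k ∈ t → V g (WithLp.toLp 2 v) = f k := by
    intro k
    by_cases hk : k ∈ t
    · obtain ⟨g, hg⟩ := hf k hk
      exact ⟨g, fun _ => hg⟩
    · exact ⟨1, fun h => absurd h hk⟩
  choose γ hγ using hf'
  refine ⟨κ, t, w, γ, hw, hw1, fun i => ?_⟩
  rw [hzP]
  rw [dist_comm, dist_eq_norm, Finset.centerMass_eq_of_sum_1 _ _ hw1] at hd
  have h1 : (∑ k ∈ t, w k • f k) i =
      ∑ k ∈ t, w k • (((ψ i (γ k))⁻¹ : Circle) : ℂ) • U (γ k) (v i) := by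
    rw [WithLp.ofLp_sum, Finset.sum_apply]
    refine Finset.sum_congr rfl fun k hk => ?_
    rw [← hγ k hk]
    rfl
  rw [← h1]
  exact (PiLp.norm_apply_le (∑ k ∈ t, w k • f k - z) i).trans_lt hd

/-! ### Positive kernels with finite spectrum -/

/-- The operator `(1 / |F|) ∑_{χ, χ' ∈ F} P_{χ' / χ}`, the average of `k(g) U_g` over the group with
the positive kernel `k(g) = |∑_{χ ∈ F} χ(g)|² / |F|`. -/
noncomputable def folnerAverage (U : G →* (H ≃ₗᵢ[ℂ] H)) (F : Finset (G →* Circle)) : H →L[ℂ] H :=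
  (F.card : ℂ)⁻¹ • ∑ p ∈ F ×ˢ F, eigenprojection U (p.2 / p.1)

theorem folnerAverage_apply (U : G →* (H ≃ₗᵢ[ℂ] H)) (F : Finset (G →* Circle)) (x : H) :
    folnerAverage U F x = (F.card : ℂ)⁻¹ • ∑ p ∈ F ×ˢ F, eigenprojection U (p.2 / p.1) x := by
  rw [folnerAverage, _root_.smul_apply, _root_.sum_apply]

theorem folnerAverage_apply_of_mem [DecidableEq (G →* Circle)] (U : G →* (H ≃ₗᵢ[ℂ] H))
    (F : Finset (G →* Circle)) (φ : G →* Circle) {y : H}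
    (hy : y ∈ jointEigenspace U fun g => φ g) :
    folnerAverage U F y = ((F.card : ℂ)⁻¹ * (F.filter fun χ => φ * χ ∈ F).card) • y := by
  rw [folnerAverage_apply, mul_smul, Finset.sum_product]
  congr 1
  simp only [eigenprojection_apply_of_mem U _ φ hy, div_eq_iff_eq_mul, Finset.sum_ite_eq']
  rw [← Finset.sum_filter, Finset.sum_const, Nat.cast_smul_eq_nsmul]

/-- The kernel `|∑_{χ ∈ F} χ(g)|² / |F|`, expanded into characters. -/
theorem folnerKernel_eq (F : Finset (G →* Circle)) (g : G) :
    (((F.card : ℝ)⁻¹ * ‖∑ χ ∈ F, (χ g : ℂ)‖ ^ 2 : ℝ) : ℂ) =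
      (F.card : ℂ)⁻¹ * ∑ p ∈ F ×ˢ F, ((((p.2 / p.1) g)⁻¹ : Circle) : ℂ) := by
  push_cast
  congr 1
  rw [← Complex.mul_conj', map_sum, Finset.sum_mul_sum, Finset.sum_product]
  refine Finset.sum_congr rfl fun χ _ => Finset.sum_congr rfl fun χ' _ => ?_
  rw [← Circle.coe_inv_eq_conj, ← Circle.coe_mul, ← Circle.coe_inv, MonoidHom.div_apply, inv_div,
    div_eq_mul_inv]

/-- `folnerAverage` is approximated by combinations of the `U g` with nonnegative coefficients of
sum at most `2`. The bound on the sum is tested on an invariant unit vector. -/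
theorem exists_weights_near_folnerAverage (U : G →* (H ≃ₗᵢ[ℂ] H)) {Ω : H} (hΩ : ‖Ω‖ = 1)
    (hfix : ∀ g, U g Ω = Ω) {F : Finset (G →* Circle)} (hF : F.Nonempty) (y : H) {ε : ℝ}
    (hε : 0 < ε) :
    ∃ (κ : Type) (t : Finset κ) (c : κ → ℝ) (γ : κ → G), (∀ k ∈ t, 0 ≤ c k) ∧ ∑ k ∈ t, c k ≤ 2 ∧
      ‖∑ k ∈ t, c k • U (γ k) y - folnerAverage U F y‖ < ε := by
  classical
  have hcard : (0 : ℝ) < F.card := by exact_mod_cast hF.card_pos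
  have hmin : 0 < min 1 (ε / 2) := lt_min one_pos (half_pos hε)
  -- `|F|²` errors are multiplied by `1 / |F|`, whence the tolerance `min 1 (ε / 2) / |F|`; the
  -- vector `Ω` is treated together with `y`, with the same weights
  obtain ⟨κ, t, w, γ, hw, hw1, happ⟩ := exists_weights_near_eigenprojection U
    (ι := (F ×ˢ F : Finset _) × Bool) (fun i => i.1.1.2 / i.1.1.1) (fun i => if i.2 then Ω else y)
    (div_pos hmin hcard)
  let c : κ → ℝ := fun k => w k * ((F.card : ℝ)⁻¹ * ‖∑ χ ∈ F, (χ (γ k) : ℂ)‖ ^ 2)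
  have hc : ∀ k ∈ t, 0 ≤ c k := fun k hk => mul_nonneg (hw k hk) (by positivity)
  have key : ∀ b : Bool, ‖∑ k ∈ t, c k • U (γ k) (if b then Ω else y) -
      folnerAverage U F (if b then Ω else y)‖ ≤ min 1 (ε / 2) := by
    intro b
    set v := if b then Ω else y with hv
    have h1 : ∀ k, c k • U (γ k) v = (F.card : ℂ)⁻¹ • ∑ p ∈ F ×ˢ F,
        w k • ((((p.2 / p.1) (γ k))⁻¹ : Circle) : ℂ) • U (γ k) v := by
      intro k
      rw [← Finset.smul_sum, ← Finset.sum_smul, smul_comm, smul_smul (F.card : ℂ)⁻¹,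
        ← folnerKernel_eq, Complex.coe_smul, smul_smul]
    have h2 : ∑ k ∈ t, c k • U (γ k) v - folnerAverage U F v = (F.card : ℂ)⁻¹ • ∑ p ∈ F ×ˢ F,
        (∑ k ∈ t, w k • ((((p.2 / p.1) (γ k))⁻¹ : Circle) : ℂ) • U (γ k) v -
          eigenprojection U (p.2 / p.1) v) := by
      rw [Finset.sum_sub_distrib, smul_sub, ← folnerAverage_apply, Finset.sum_comm,
        Finset.smul_sum]
      simp only [h1]
    rw [h2, norm_smul, norm_inv, Complex.norm_natCast]
    have h3 : ‖∑ p ∈ F ×ˢ F,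
        (∑ k ∈ t, w k • ((((p.2 / p.1) (γ k))⁻¹ : Circle) : ℂ) • U (γ k) v -
          eigenprojection U (p.2 / p.1) v)‖ ≤ ∑ p ∈ F ×ˢ F, min 1 (ε / 2) / F.card :=
      norm_sum_le_of_le _ fun p hp => (happ (⟨p, hp⟩, b)).le
    rw [Finset.sum_const, Finset.card_product, nsmul_eq_mul] at h3
    calc _ ≤ (F.card : ℝ)⁻¹ * (((F.card * F.card : ℕ) : ℝ) * (min 1 (ε / 2) / F.card)) := by gcongr
      _ = min 1 (ε / 2) := by
        push_cast
        field_simp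
  refine ⟨κ, t, c, γ, hc, ?_, ?_⟩
  · have h1 := key true
    simp only [if_true, hfix] at h1
    have h2 : folnerAverage U F Ω = Ω := by
      rw [folnerAverage_apply_of_mem U F 1 (fun g => by
        change U g Ω = ((1 : Circle) : ℂ) • Ω
        rw [hfix, Circle.coe_one, one_smul])]
      simp only [one_mul, Finset.filter_mem_eq_inter, Finset.inter_self]
      rw [inv_mul_cancel₀ (by exact_mod_cast hcard.ne'), one_smul]
    rw [h2, ← Finset.sum_smul] at h1
    have h3 : ‖(∑ k ∈ t, c k) • Ω‖ ≤ 1 + 1 := by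
      calc ‖(∑ k ∈ t, c k) • Ω‖ = ‖((∑ k ∈ t, c k) • Ω - Ω) + Ω‖ := by rw [sub_add_cancel]
        _ ≤ _ := (norm_add_le _ _).trans (add_le_add (h1.trans (min_le_left _ _)) hΩ.le)
    rw [norm_smul, hΩ, mul_one, Real.norm_of_nonneg (Finset.sum_nonneg hc)] at h3
    linarith
  · have h1 := key false
    simp only [Bool.false_eq_true, if_false] at h1
    exact (h1.trans (min_le_right _ _)).trans_lt (half_lt_self hε)

theorem norm_folnerAverage_le (U : G →* (H ≃ₗᵢ[ℂ] H)) {Ω : H} (hΩ : ‖Ω‖ = 1)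
    (hfix : ∀ g, U g Ω = Ω) {F : Finset (G →* Circle)} (hF : F.Nonempty) (y : H) :
    ‖folnerAverage U F y‖ ≤ 2 * ‖y‖ := by
  refine le_of_forall_pos_le_add fun ε hε => ?_
  obtain ⟨κ, t, c, γ, hc, hc2, happ⟩ := exists_weights_near_folnerAverage U hΩ hfix hF y hε
  have h1 : ‖∑ k ∈ t, c k • U (γ k) y‖ ≤ 2 * ‖y‖ := by
    refine (norm_sum_le _ _).trans ?_
    calc ∑ k ∈ t, ‖c k • U (γ k) y‖ = (∑ k ∈ t, c k) * ‖y‖ := by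
          rw [Finset.sum_mul]
          refine Finset.sum_congr rfl fun k hk => ?_
          rw [norm_smul, Real.norm_of_nonneg (hc k hk), (U _).norm_map]
      _ ≤ 2 * ‖y‖ := by gcongr
  have h2 := norm_sub_norm_le (folnerAverage U F y) (∑ k ∈ t, c k • U (γ k) y)
  rw [norm_sub_rev] at h2
  linarith

/-- On linear combinations of eigenvectors, `folnerAverage` is close to the identity for Følner sets
of characters. -/
theorem exists_folnerAverage_near_of_mem_iSup [DecidableEq (G →* Circle)] (U : G →* (H ≃ₗᵢ[ℂ] H))
    {y : H} (hy : y ∈ ⨆ χ, jointEigenspace U χ) :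
    ∃ (S : Finset (G →* Circle)) (M : ℝ), 0 ≤ M ∧ ∀ F : Finset (G →* Circle), F.Nonempty → ∀ δ : ℝ,
      (∀ s ∈ S, (1 - δ) * F.card ≤ (F.filter fun x => s * x ∈ F).card) →
        ‖folnerAverage U F y - y‖ ≤ M * δ := by
  induction hy using Submodule.iSup_induction' with
  | mem χ y hy =>
    by_cases hy0 : y = 0
    · refine ⟨∅, 0, le_rfl, fun F _ δ _ => ?_⟩
      rw [hy0, map_zero, sub_zero, norm_zero, zero_mul]
    · obtain ⟨φ, hφ⟩ := exists_character_of_eigenvector U hy hy0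
      refine ⟨{φ}, ‖y‖, norm_nonneg _, fun F hF δ hδ => ?_⟩
      obtain rfl : χ = fun g => (φ g : ℂ) := funext hφ
      have hcard : (0 : ℝ) < F.card := by exact_mod_cast hF.card_pos
      have h1 := hδ φ (Finset.mem_singleton_self φ)
      have h2 : ((F.filter fun x => φ * x ∈ F).card : ℝ) ≤ F.card := by
        exact_mod_cast Finset.card_filter_le _ _
      set q := (F.filter fun x => φ * x ∈ F).card
      have h3 : folnerAverage U F y - y = (((F.card : ℝ)⁻¹ * q - 1 : ℝ) : ℂ) • y := by
        rw [folnerAverage_apply_of_mem U F φ hy]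
        push_cast
        rw [sub_smul, one_smul]
      rw [h3, norm_smul, Complex.norm_real, mul_comm]
      refine mul_le_mul_of_nonneg_left ?_ (norm_nonneg _)
      rw [Real.norm_eq_abs, abs_le, inv_mul_eq_div]
      have h4 : 1 - δ ≤ q / F.card := by rwa [le_div_iff₀ hcard]
      have h5 : (q : ℝ) / F.card ≤ 1 := by rwa [div_le_one hcard]
      constructor <;> linarith
  | zero =>
    refine ⟨∅, 0, le_rfl, fun F _ δ _ => ?_⟩
    rw [map_zero, sub_zero, norm_zero, zero_mul]
  | add y z _ _ h1 h2 =>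
    obtain ⟨S₁, M₁, hM₁, h1⟩ := h1
    obtain ⟨S₂, M₂, hM₂, h2⟩ := h2
    refine ⟨S₁ ∪ S₂, M₁ + M₂, add_nonneg hM₁ hM₂, fun F hF δ hδ => ?_⟩
    have e1 := h1 F hF δ fun s hs => hδ s (Finset.mem_union_left _ hs)
    have e2 := h2 F hF δ fun s hs => hδ s (Finset.mem_union_right _ hs)
    rw [map_add, add_sub_add_comm, add_mul]
    exact (norm_add_le _ _).trans (add_le_add e1 e2)

/-- A limit of linear combinations of eigenvectors is approximated by its averages with positive
kernels of finite spectrum. -/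
theorem exists_folnerAverage_near (U : G →* (H ≃ₗᵢ[ℂ] H)) {Ω : H} (hΩ : ‖Ω‖ = 1)
    (hfix : ∀ g, U g Ω = Ω) {x : H} (hx : x ∈ eigenvectorSpan U) {ε : ℝ} (hε : 0 < ε) :
    ∃ F : Finset (G →* Circle), F.Nonempty ∧ ‖folnerAverage U F x - x‖ < ε := by
  classical
  obtain ⟨y, hy, hd⟩ := Metric.mem_closure_iff.1 (show x ∈ closure _ from hx) (ε / 4)
    (by positivity)
  obtain ⟨S, M, hM, hS⟩ := exists_folnerAverage_near_of_mem_iSup U hy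
  have hδ : 0 < ε / (4 * (M + 1)) := by positivity
  obtain ⟨F, hF, hFS⟩ := exists_folner_finset S hδ
  refine ⟨F, hF, ?_⟩
  have h1 := hS F hF _ hFS
  have h2 : M * (ε / (4 * (M + 1))) ≤ ε / 4 := by
    rw [mul_div_assoc', div_le_div_iff₀ (by positivity) (by positivity)]
    nlinarith
  have h3 := norm_folnerAverage_le U hΩ hfix hF (x - y)
  rw [dist_eq_norm] at hd
  have h4 : folnerAverage U F x - x =
      folnerAverage U F (x - y) + (folnerAverage U F y - y) - (x - y) := by
    rw [map_sub]
    abel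
  rw [h4]
  have h5 := norm_sub_le (folnerAverage U F (x - y) + (folnerAverage U F y - y)) (x - y)
  have h6 := norm_add_le (folnerAverage U F (x - y)) (folnerAverage U F y - y)
  linarith

end MeanErgodic

/-! ### Generated von Neumann algebras and lifts of ⋆-homomorphisms -/

namespace VonNeumannAlgebra

variable {K : Type*} [NormedAddCommGroup K] [InnerProductSpace ℂ K] [CompleteSpace K]

theorem coe_generatedBy (S : Set (K →L[ℂ] K)) : (generatedBy S : Set (K →L[ℂ] K)) =
    Set.centralizer (Set.centralizer (S ∪ star S)) := by
  change ((StarSubalgebra.centralizer ℂ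
    (StarSubalgebra.centralizer ℂ S : Set (K →L[ℂ] K)) : StarSubalgebra ℂ _) : Set (K →L[ℂ] K)) = _
  have h : star (StarSubalgebra.centralizer ℂ S : Set (K →L[ℂ] K)) =
      (StarSubalgebra.centralizer ℂ S : Set (K →L[ℂ] K)) := by
    ext x
    rw [Set.mem_star, SetLike.mem_coe, SetLike.mem_coe, star_mem_iff]
  rw [StarSubalgebra.coe_centralizer, h, Set.union_self, StarSubalgebra.coe_centralizer]

theorem subset_generatedBy (S : Set (K →L[ℂ] K)) : S ⊆ generatedBy S := by
  rw [coe_generatedBy]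
  exact Set.subset_union_left.trans Set.subset_centralizer_centralizer

theorem generatedBy_subset {S : Set (K →L[ℂ] K)} {N : VonNeumannAlgebra K} (h : S ⊆ N) :
    (generatedBy S : Set (K →L[ℂ] K)) ⊆ N := by
  rw [coe_generatedBy, ← N.centralizer_centralizer]
  refine Set.centralizer_subset (Set.centralizer_subset (Set.union_subset h ?_))
  intro x hx
  have := h (Set.mem_star.1 hx)
  rw [SetLike.mem_coe] at this ⊢
  rwa [star_mem_iff] at this

/-- The commutant of a self-adjoint operator, as a von Neumann algebra. -/
noncomputable def commutantOf (p : K →L[ℂ] K) : VonNeumannAlgebra K where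
  toStarSubalgebra := StarSubalgebra.centralizer ℂ {p}
  centralizer_centralizer' := Set.centralizer_centralizer_centralizer _

theorem mem_commutantOf {p : K →L[ℂ] K} (hp : IsSelfAdjoint p) {a : K →L[ℂ] K} :
    a ∈ commutantOf p ↔ p * a = a * p := by
  change a ∈ StarSubalgebra.centralizer ℂ {p} ↔ _
  rw [StarSubalgebra.mem_centralizer_iff]
  simp [hp.star_eq]

end VonNeumannAlgebra

/-- The factorization of a ⋆-homomorphism through an injective one. -/
noncomputable def StarAlgHom.liftOfInjective {B C D : Type*} [CStarAlgebra B] [CStarAlgebra C]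
    [CStarAlgebra D] (φ : B →⋆ₐ[ℂ] C) (hφ : Function.Injective φ) (ψ : D →⋆ₐ[ℂ] C)
    (h : ∀ d, ∃ b, φ b = ψ d) : D →⋆ₐ[ℂ] B where
  toFun d := (h d).choose
  map_one' := hφ (by rw [(h 1).choose_spec, map_one, map_one])
  map_mul' x y := hφ (by
    rw [(h (x * y)).choose_spec, map_mul, map_mul, (h x).choose_spec, (h y).choose_spec])
  map_zero' := hφ (by rw [(h 0).choose_spec, map_zero, map_zero])
  map_add' x y := hφ (by
    rw [(h (x + y)).choose_spec, map_add, map_add, (h x).choose_spec, (h y).choose_spec])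
  commutes' r := hφ (by rw [(h _).choose_spec, AlgHomClass.commutes, AlgHomClass.commutes])
  map_star' x := hφ (by rw [(h (star x)).choose_spec, map_star, map_star, (h x).choose_spec])

theorem StarAlgHom.liftOfInjective_spec {B C D : Type*} [CStarAlgebra B] [CStarAlgebra C]
    [CStarAlgebra D] (φ : B →⋆ₐ[ℂ] C) (hφ : Function.Injective φ) (ψ : D →⋆ₐ[ℂ] C)
    (h : ∀ d, ∃ b, φ b = ψ d) (d : D) : φ (StarAlgHom.liftOfInjective φ hφ ψ h d) = ψ d :=
  (h d).choose_spec

/-- The restriction of the elements of a von Neumann algebra to an invariant closed subspace. -/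
noncomputable def VonNeumannAlgebra.restrictTo {K : Type*} [NormedAddCommGroup K]
    [InnerProductSpace ℂ K] [CompleteSpace K] (N : VonNeumannAlgebra K) (V : Submodule ℂ K)
    [CompleteSpace V] (h : ∀ a ∈ N, ∀ x ∈ V, a x ∈ V) : N.Elem →⋆ₐ[ℂ] (V →L[ℂ] V) where
  toFun a := (N.incl a).restrict (h _ (Subtype.prop a))
  map_one' := rfl
  map_mul' _ _ := rfl
  map_zero' := rfl
  map_add' _ _ := rfl
  commutes' _ := rfl
  map_star' a := by
    rw [ContinuousLinearMap.star_eq_adjoint, ContinuousLinearMap.eq_adjoint_iff]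
    intro x y
    rw [Submodule.coe_inner, Submodule.coe_inner, ContinuousLinearMap.coe_restrict_apply,
      ContinuousLinearMap.coe_restrict_apply, map_star, ContinuousLinearMap.star_eq_adjoint,
      ContinuousLinearMap.adjoint_inner_left]

/-! ### Subsystems -/

namespace WStarSystem

variable {G : Type*} [Group G]
variable {K : Type*} [NormedAddCommGroup K] [InnerProductSpace ℂ K] [CompleteSpace K]
variable {L : Type*} [NormedAddCommGroup L] [InnerProductSpace ℂ L] [CompleteSpace L]

/-- The system structure on a von Neumann algebra `N`, induced by an injective ⋆-homomorphism `κ`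
into the algebra of a system, whose range is invariant under the dynamics. -/
noncomputable def induced (A : WStarSystem G K) (N : VonNeumannAlgebra L)
    (κ : N.Elem →⋆ₐ[ℂ] A.alg.Elem) (hκ : Function.Injective κ)
    (hinv : ∀ g b, ∃ b', κ b' = A.action g (κ b))
    (hnormal : IsNormalFunctional N fun b => A.state (κ b)) : WStarSystem G L where
  alg := N
  state := PositiveLinearMap.mk₀ (A.state.toLinearMap ∘ₗ (κ : N.Elem →ₗ[ℂ] A.alg.Elem))
    (fun b hb => by
      obtain ⟨c, rfl⟩ := CStarAlgebra.nonneg_iff_eq_star_mul_self.1 hb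
      change 0 ≤ A.state (κ (star c * c))
      rw [map_mul, map_star]
      exact A.state.map_nonneg (star_mul_self_nonneg _))
  state_one := by
    change A.state (κ 1) = 1
    rw [map_one, A.state_one]
  faithful b hb := by
    change A.state (κ (star b * b)) = 0 at hb
    rw [map_mul, map_star] at hb
    exact hκ ((A.faithful _ hb).trans (map_zero κ).symm)
  normal := hnormal
  action :=
    let lift : G → N.Elem →⋆ₐ[ℂ] N.Elem := fun g =>
      StarAlgHom.liftOfInjective κ hκ ((A.action g : A.alg.Elem →⋆ₐ[ℂ] A.alg.Elem).comp κ) (hinv g)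
    have hlift : ∀ g b, κ (lift g b) = A.action g (κ b) := fun g =>
      StarAlgHom.liftOfInjective_spec κ hκ _ (hinv g)
    { toFun := fun g => StarAlgEquiv.ofStarAlgHom (lift g) (lift g⁻¹)
        (StarAlgHom.ext fun b => hκ (by
          change κ (lift g⁻¹ (lift g b)) = κ b
          rw [hlift, hlift, ← StarAlgEquiv.mul_apply, ← map_mul, inv_mul_cancel, map_one]
          rfl))
        (StarAlgHom.ext fun b => hκ (by
          change κ (lift g (lift g⁻¹ b)) = κ b
          rw [hlift, hlift, ← StarAlgEquiv.mul_apply, ← map_mul, mul_inv_cancel, map_one]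
          rfl))
      map_one' := StarAlgEquiv.ext fun b => hκ (by
        change κ (lift 1 b) = κ b
        rw [hlift, map_one]
        rfl)
      map_mul' := fun g h => StarAlgEquiv.ext fun b => hκ (by
        change κ (lift (g * h) b) = κ (lift g (lift h b))
        rw [hlift, hlift, hlift, map_mul]
        rfl) }
  invariant g b := by
    exact (congrArg A.state (StarAlgHom.liftOfInjective_spec κ hκ
      ((A.action g : A.alg.Elem →⋆ₐ[ℂ] A.alg.Elem).comp κ) (hinv g) b)).trans (A.invariant g _)

section Induced

variable (A : WStarSystem G K) (N : VonNeumannAlgebra L) (κ : N.Elem →⋆ₐ[ℂ] A.alg.Elem)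
  (hκ : Function.Injective κ) (hinv : ∀ g b, ∃ b', κ b' = A.action g (κ b))
  (hnormal : IsNormalFunctional N fun b => A.state (κ b))

theorem induced_isImbedding (M : VonNeumannAlgebra K)
    (hM : (M : Set (K →L[ℂ] K)) = Set.range fun a => (κ a : K →L[ℂ] K)) :
    IsImbedding (A.induced N κ hκ hinv hnormal) A κ where
  injective := hκ
  range_eq := ⟨M, hM⟩
  state_eq _ := rfl
  action_eq g a := (StarAlgHom.liftOfInjective_spec κ hκ
    ((A.action g : A.alg.Elem →⋆ₐ[ℂ] A.alg.Elem).comp κ) (hinv g) a).symm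

end Induced

section GNSMap

variable {F : WStarSystem G L} {A : WStarSystem G K} {ζ : F.alg.Elem →⋆ₐ[ℂ] A.alg.Elem}

/-- An imbedding of systems induces an isometry of the GNS spaces, which intertwines the unitary
representations. -/
theorem IsImbedding.exists_isometry (hζ : IsImbedding F A ζ) :
    ∃ J : F.H →ₗᵢ[ℂ] A.H, (∀ a, J (F.vec a) = A.vec (ζ a)) ∧
      ∀ g x, J (F.unitary g x) = A.unitary g (J x) := by
  let j₀ : F.state.PreGNS →ₗ[ℂ] A.state.PreGNS :=
    A.state.toPreGNS.toLinearMap ∘ₗ (ζ : F.alg.Elem →ₗ[ℂ] A.alg.Elem) ∘ₗ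
      F.state.ofPreGNS.toLinearMap
  have hj₀ : ∀ x, ‖j₀ x‖ = ‖x‖ := by
    intro x
    rw [PositiveLinearMap.preGNS_norm_def, PositiveLinearMap.preGNS_norm_def]
    change √(A.state (star (ζ (F.state.ofPreGNS x)) * ζ (F.state.ofPreGNS x))).re = _
    rw [← map_star, ← map_mul, hζ.state_eq]
  let j : F.state.PreGNS →L[ℂ] A.state.PreGNS :=
    j₀.mkContinuous 1 fun x => by rw [hj₀, one_mul]
  let J : F.H →L[ℂ] A.H := j.completion
  have hJ : ∀ a, J (F.vec a) = A.vec (ζ a) := by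
    intro a
    rw [vec_eq_coe, vec_eq_coe]
    exact UniformSpace.Completion.map_coe j.uniformContinuous _
  have hnorm : ∀ x, ‖J x‖ = ‖x‖ := by
    intro x
    refine congrFun (F.denseRange_vec.equalizer (g := fun x => ‖J x‖) (h := fun x => ‖x‖)
      (by fun_prop) (by fun_prop) (funext fun a => ?_)) x
    have h : ⟪J (F.vec a), J (F.vec a)⟫_ℂ = ⟪F.vec a, F.vec a⟫_ℂ := by
      rw [hJ, inner_vec, inner_vec, ← map_star, ← map_mul, hζ.state_eq]
    change ‖J (F.vec a)‖ = ‖F.vec a‖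
    rw [norm_eq_sqrt_re_inner (𝕜 := ℂ), h, ← norm_eq_sqrt_re_inner]
  refine ⟨⟨(J : F.H →ₗ[ℂ] A.H), hnorm⟩, hJ, fun g x => ?_⟩
  have h : J ∘L F.unitary g = A.unitary g ∘L J := by
    refine DFunLike.coe_injective (F.denseRange_vec.equalizer (ContinuousLinearMap.continuous _)
      (ContinuousLinearMap.continuous _) (funext fun a => ?_))
    change J (F.unitary g (F.vec a)) = A.unitary g (J (F.vec a))
    rw [unitary_vec, hJ, hJ, unitary_vec, hζ.action_eq]
  exact congrArg (fun b : F.H →L[ℂ] A.H => b x) h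

end GNSMap

/-! ### The algebra generated by the eigenoperators -/

section Eigen

variable (A : WStarSystem G K)

theorem H0_eq : A.H0 = eigenvectorSpan A.unitaryHom := by
  rw [H0, eigenvectorSpan]
  congr 1
  refine le_antisymm (Submodule.span_le.2 ?_) (iSup_le fun χ x hx => ?_)
  · rintro x ⟨χ, -, hx⟩
    exact Submodule.mem_iSup_of_mem χ hx
  · by_cases hx0 : x = 0
    · rw [hx0]
      exact Submodule.zero_mem _
    · exact Submodule.subset_span ⟨χ, hx0, hx⟩

theorem isClosed_H0 : IsClosed (A.H0 : Set A.H) := Submodule.isClosed_topologicalClosure _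

theorem unitary_cyclicVector (g : G) : A.unitary g A.cyclicVector = A.cyclicVector := by
  rw [← vec_one, unitary_vec, map_one]

theorem cyclicVector_mem_H0 : A.cyclicVector ∈ A.H0 := by
  rw [H0_eq]
  refine jointEigenspace_le_eigenvectorSpan A.unitaryHom (fun _ => 1) fun g => ?_
  rw [one_smul]
  exact A.unitary_cyclicVector g

theorem unitary_mem_H0 (g : G) {x : A.H} (hx : x ∈ A.H0) : A.unitary g x ∈ A.H0 := by
  rw [H0_eq] at hx ⊢
  exact unitaryRep_mem_eigenvectorSpan A.unitaryHom g hx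

/-- An eigenoperator maps eigenvectors to eigenvectors, hence `H₀` into itself. -/
theorem rep_mem_H0_of_eigenoperator {u : A.alg.Elem} {χ : G → ℂ}
    (hu : ∀ g, A.action g u = χ g • u) {x : A.H} (hx : x ∈ A.H0) : A.rep u x ∈ A.H0 := by
  rw [H0_eq] at hx ⊢
  have h1 : (⨆ χ, jointEigenspace A.unitaryHom χ) ≤
      (⨆ χ, jointEigenspace A.unitaryHom χ).comap (A.rep u : A.H →ₗ[ℂ] A.H) := by
    refine iSup_le fun χ' y hy => ?_
    refine Submodule.mem_iSup_of_mem (fun g => χ g * χ' g) fun g => ?_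
    change A.unitary g (A.rep u y) = (χ g * χ' g) • A.rep u y
    rw [unitary_rep_apply, hu, show A.unitary g y = χ' g • y from hy g, map_smul, map_smul,
      _root_.smul_apply, smul_smul, mul_comm]
  exact map_mem_closure (A.rep u).continuous hx h1

theorem action_star_of_eigenoperator {u : A.alg.Elem} {χ : G → ℂ}
    (hu : ∀ g, A.action g u = χ g • u) (g : G) :
    A.action g (star u) = star (χ g) • star u := by
  rw [map_star, hu, star_smul]

theorem mem_eigenAlgebra_of_eigenoperator {u : A.alg.Elem} {χ : G → ℂ}
    (hu : ∀ g, A.action g u = χ g • u) : (u : K →L[ℂ] K) ∈ A.eigenAlgebra := by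
  by_cases h0 : u = 0
  · rw [h0, map_zero]
    exact zero_mem _
  · exact VonNeumannAlgebra.subset_generatedBy _ ⟨u, rfl, h0, χ, hu⟩

theorem eigenAlgebra_le {a : K →L[ℂ] K} (ha : a ∈ A.eigenAlgebra) : a ∈ A.alg := by
  refine VonNeumannAlgebra.generatedBy_subset (N := A.alg) ?_ ha
  rintro _ ⟨u, rfl, -⟩
  exact Subtype.prop u

/-- The operators of `A^K`, in the GNS representation, leave `H₀` invariant: the operators which
commute with the projection onto `H₀` form a von Neumann algebra, and so do their preimages
in `A`. -/
theorem rep_mem_H0 {a : A.alg.Elem} (ha : (a : K →L[ℂ] K) ∈ A.eigenAlgebra) {x : A.H}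
    (hx : x ∈ A.H0) : A.rep a x ∈ A.H0 := by
  let P := A.H0.starProjection
  have hP : IsSelfAdjoint P := isSelfAdjoint_starProjection _
  obtain ⟨N, hN⟩ := A.exists_vonNeumannAlgebra_eq_rep_preimage (VonNeumannAlgebra.commutantOf P)
  have hsub : A.eigenoperators ⊆ N := by
    rintro _ ⟨u, rfl, -, χ, hu⟩
    rw [hN]
    refine ⟨u, (VonNeumannAlgebra.mem_commutantOf hP).2 ?_, rfl⟩
    ext y
    change P (A.rep u y) = A.rep u (P y)
    refine Submodule.eq_starProjection_of_mem_orthogonal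
      (A.rep_mem_H0_of_eigenoperator hu (Submodule.starProjection_apply_mem _ _)) ?_
    rw [← map_sub]
    intro z hz
    rw [← ContinuousLinearMap.adjoint_inner_left, ← ContinuousLinearMap.star_eq_adjoint, ← map_star]
    exact Submodule.sub_starProjection_mem_orthogonal (K := A.H0) y _
      (A.rep_mem_H0_of_eigenoperator (A.action_star_of_eigenoperator hu) hz)
  have haN := VonNeumannAlgebra.generatedBy_subset hsub ha
  rw [hN] at haN
  obtain ⟨b, hb, hba⟩ := haN
  rw [A.alg.incl_injective hba] at hb
  have h1 := congrArg (fun t : A.H →L[ℂ] A.H => t x) ((VonNeumannAlgebra.mem_commutantOf hP).1 hb)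
  change P (A.rep a x) = A.rep a (P x) at h1
  rw [Submodule.starProjection_eq_self_iff.2 hx] at h1
  rw [← h1]
  exact Submodule.starProjection_apply_mem _ _

/-- A vector which is approximated by averages of the orbit of `π_μ(a) Ω_μ`, with nonnegative
coefficients of bounded sum and with a phase, is `π_μ(b) Ω_μ` for some `b` in the algebra. -/
theorem exists_vec_eq_of_near_averages {a : A.alg.Elem} {z : A.H} {C : ℝ}
    (h : ∀ ε > 0, ∃ (κ : Type) (t : Finset κ) (c : κ → ℝ) (θ : κ → Circle) (γ : κ → G),
      (∀ k ∈ t, 0 ≤ c k) ∧ ∑ k ∈ t, c k ≤ C ∧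
        ‖∑ k ∈ t, c k • (θ k : ℂ) • A.unitary (γ k) (A.vec a) - z‖ < ε) :
    ∃ b : A.alg.Elem, ‖b‖ ≤ C * ‖a‖ ∧ A.vec b = z := by
  have hcl := A.isClosed_vec_ball A.alg (C * ‖a‖)
  suffices hz : z ∈ closure (A.vec '' {d | (d : K →L[ℂ] K) ∈ A.alg ∧ ‖d‖ ≤ C * ‖a‖}) by
    rw [hcl.closure_eq] at hz
    obtain ⟨b, hb, rfl⟩ := hz
    exact ⟨b, hb.2, rfl⟩
  rw [Metric.mem_closure_iff]
  intro ε hε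
  obtain ⟨κ, t, c, θ, γ, hc, hcC, hd⟩ := h ε hε
  refine ⟨_, ⟨∑ k ∈ t, (c k : ℂ) • (θ k : ℂ) • A.action (γ k) a, ⟨Subtype.prop _, ?_⟩, rfl⟩, ?_⟩
  · refine (norm_sum_le _ _).trans ?_
    calc ∑ k ∈ t, ‖(c k : ℂ) • (θ k : ℂ) • A.action (γ k) a‖ = (∑ k ∈ t, c k) * ‖a‖ := by
          rw [Finset.sum_mul]
          refine Finset.sum_congr rfl fun k hk => ?_
          rw [norm_smul, norm_smul, Circle.norm_coe, one_mul, Complex.norm_real,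
            Real.norm_of_nonneg (hc k hk), NonUnitalStarAlgHom.norm_map (A.action (γ k))
            (A.action (γ k)).injective]
      _ ≤ C * ‖a‖ := by gcongr
  · have hvec : ∀ k, A.vec ((c k : ℂ) • (θ k : ℂ) • A.action (γ k) a) =
        c k • (θ k : ℂ) • A.unitary (γ k) (A.vec a) := by
      intro k
      rw [map_smul, map_smul, unitary_vec, Complex.coe_smul]
    rw [dist_comm, dist_eq_norm, map_sum]
    simp only [hvec]
    exact hd

/-- The projection of `π_μ(a) Ω_μ` onto a joint eigenspace is given by an eigenoperator. -/
theorem exists_eigenoperator_vec_eq (ψ : G →* Circle) (a : A.alg.Elem) :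
    ∃ b : A.alg.Elem, A.vec b = eigenprojection A.unitaryHom ψ (A.vec a) ∧
      ∀ g, A.action g b = (ψ g : ℂ) • b := by
  obtain ⟨b, -, hb⟩ := A.exists_vec_eq_of_near_averages (a := a) (C := 1)
    (z := eigenprojection A.unitaryHom ψ (A.vec a)) (fun ε hε => by
      obtain ⟨κ, t, w, γ, hw, hw1, h⟩ := exists_weights_near_eigenprojection A.unitaryHom
        (ι := Unit) (fun _ => ψ) (fun _ => A.vec a) hε
      exact ⟨κ, t, w, fun k => (ψ (γ k))⁻¹, γ, hw, hw1.le, h ()⟩)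
  refine ⟨b, hb, fun g => A.vec_injective ?_⟩
  rw [← unitary_vec, hb, map_smul, hb]
  exact eigenprojection_mem A.unitaryHom ψ (A.vec a) g

/-- The Følner averages of `π_μ(a) Ω_μ` are given by elements of `A^K` of norm at most `2 ‖a‖`. -/
theorem exists_mem_eigenAlgebra_vec_eq_folnerAverage {F : Finset (G →* Circle)} (hF : F.Nonempty)
    (a : A.alg.Elem) : ∃ b : A.alg.Elem, (b : K →L[ℂ] K) ∈ A.eigenAlgebra ∧ ‖b‖ ≤ 2 * ‖a‖ ∧
      A.vec b = folnerAverage A.unitaryHom F (A.vec a) := by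
  obtain ⟨b, hb2, hb⟩ := A.exists_vec_eq_of_near_averages (a := a) (C := 2)
    (z := folnerAverage A.unitaryHom F (A.vec a)) (fun ε hε => by
      obtain ⟨κ, t, c, γ, hc, hc2, h⟩ := exists_weights_near_folnerAverage A.unitaryHom
        A.norm_cyclicVector A.unitary_cyclicVector hF (A.vec a) hε
      refine ⟨κ, t, c, fun _ => 1, γ, hc, hc2, ?_⟩
      simp only [Circle.coe_one, one_smul]
      exact h)
  refine ⟨b, ?_, hb2, hb⟩
  choose e he hact using fun ψ : G →* Circle => A.exists_eigenoperator_vec_eq ψ a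
  have : b = (F.card : ℂ)⁻¹ • ∑ p ∈ F ×ˢ F, e (p.2 / p.1) := by
    refine A.vec_injective ?_
    rw [hb, folnerAverage_apply, map_smul, map_sum]
    simp only [he]
  rw [this, map_smul, map_sum]
  exact SMulMemClass.smul_mem _ (sum_mem fun p _ => A.mem_eigenAlgebra_of_eigenoperator (hact _))

/-- If `π_μ(a) Ω_μ` lies in `H₀`, it is a limit of its Følner averages, which come from a ball of
`A^K`. -/
theorem mem_eigenAlgebra_of_vec_mem_H0 {a : A.alg.Elem} (ha : A.vec a ∈ A.H0) :
    (a : K →L[ℂ] K) ∈ A.eigenAlgebra := by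
  have hcl := A.isClosed_vec_ball A.eigenAlgebra (2 * ‖a‖)
  have hmem : A.vec a ∈
      closure (A.vec '' {d | (d : K →L[ℂ] K) ∈ A.eigenAlgebra ∧ ‖d‖ ≤ 2 * ‖a‖}) := by
    rw [Metric.mem_closure_iff]
    intro ε hε
    rw [H0_eq] at ha
    obtain ⟨F, hF, hd⟩ := exists_folnerAverage_near A.unitaryHom A.norm_cyclicVector
      A.unitary_cyclicVector ha hε
    obtain ⟨b, hb, hb2, hbv⟩ := A.exists_mem_eigenAlgebra_vec_eq_folnerAverage hF a
    refine ⟨_, ⟨b, ⟨hb, hb2⟩, rfl⟩, ?_⟩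
    rw [dist_comm, dist_eq_norm, hbv]
    exact hd
  rw [hcl.closure_eq] at hmem
  obtain ⟨b, hb, hba⟩ := hmem
  rw [← A.vec_injective hba]
  exact hb.1

theorem mem_eigenAlgebra_iff (a : A.alg.Elem) :
    (a : K →L[ℂ] K) ∈ A.eigenAlgebra ↔ A.vec a ∈ A.H0 :=
  ⟨fun ha => A.rep_mem_H0 ha A.cyclicVector_mem_H0, A.mem_eigenAlgebra_of_vec_mem_H0⟩

theorem action_mem_eigenAlgebra (g : G) {a : A.alg.Elem} (ha : (a : K →L[ℂ] K) ∈ A.eigenAlgebra) :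
    (A.action g a : K →L[ℂ] K) ∈ A.eigenAlgebra := by
  rw [mem_eigenAlgebra_iff] at ha ⊢
  rw [← unitary_vec]
  exact A.unitary_mem_H0 g ha

theorem compactPart_eq : A.compactPart = A.rep '' {d | (d : K →L[ℂ] K) ∈ A.eigenAlgebra} := by
  ext t
  constructor
  · rintro ⟨⟨a, rfl⟩, ha⟩
    exact ⟨a, (A.mem_eigenAlgebra_iff a).2 ha, rfl⟩
  · rintro ⟨a, ha, rfl⟩
    exact ⟨⟨a, rfl⟩, (A.mem_eigenAlgebra_iff a).1 ha⟩

/-- `A^K Ω_μ` is dense in `H₀`. -/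
theorem closure_vec_eigenAlgebra :
    closure (A.vec '' {d | (d : K →L[ℂ] K) ∈ A.eigenAlgebra}) = A.H0 := by
  refine Set.Subset.antisymm (closure_minimal ?_ A.isClosed_H0) ?_
  · rintro _ ⟨a, ha, rfl⟩
    exact (A.mem_eigenAlgebra_iff a).1 ha
  let W : Submodule ℂ A.H := (A.eigenAlgebra.toStarSubalgebra.comap
    A.alg.incl).toSubalgebra.toSubmodule.map A.vec
  have hW : (W : Set A.H) = A.vec '' {d | (d : K →L[ℂ] K) ∈ A.eigenAlgebra} := rfl
  have hle : (⨆ χ, jointEigenspace A.unitaryHom χ) ≤ W.topologicalClosure := by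
    refine iSup_le fun χ y hy => ?_
    by_cases hy0 : y = 0
    · rw [hy0]
      exact Submodule.zero_mem _
    obtain ⟨ψ, hψ⟩ := exists_character_of_eigenvector A.unitaryHom hy hy0
    obtain rfl : χ = fun g => (ψ g : ℂ) := funext hψ
    classical
    have hyP : eigenprojection A.unitaryHom ψ y = y := by
      rw [eigenprojection_apply_of_mem A.unitaryHom ψ ψ hy, if_pos rfl]
    rw [← hyP]
    refine map_mem_closure (s := Set.range A.vec) (eigenprojection A.unitaryHom ψ).continuous
      (A.denseRange_vec y) ?_
    rintro _ ⟨a, rfl⟩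
    obtain ⟨b, hb, hact⟩ := A.exists_eigenoperator_vec_eq ψ a
    exact ⟨b, A.mem_eigenAlgebra_of_eigenoperator hact, hb⟩
  rw [H0_eq, ← hW]
  exact closure_minimal hle isClosed_closure

end Eigen

end WStarSystem

/-! ### Normal functionals -/

section Normal

variable {K : Type*} [NormedAddCommGroup K] [InnerProductSpace ℂ K] [CompleteSpace K]

/-- Vector functionals are normal. -/
theorem isNormalFunctional_inner (M : VonNeumannAlgebra K) (ξ η : K) :
    IsNormalFunctional M fun a => ⟪ξ, (a : K →L[ℂ] K) η⟫_ℂ := by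
  let s : K → ℕ → K := fun ξ n => if n = 0 then ξ else 0
  have hs : ∀ ξ, Summable fun n => ‖s ξ n‖ ^ 2 := fun ξ =>
    summable_of_ne_finset_zero (s := {0}) fun n hn => by
      have : n ≠ 0 := by simpa using hn
      simp [s, this]
  have h1 : @Continuous _ _ (sigmaWeakTopology K) inferInstance
      (fun a : K →L[ℂ] K => ∑' n, ⟪s ξ n, a (s η n)⟫_ℂ) :=
    continuous_iInf_dom (i := ⟨(s ξ, s η), hs ξ, hs η⟩) continuous_induced_dom
  have h2 : (fun a : K →L[ℂ] K => ∑' n, ⟪s ξ n, a (s η n)⟫_ℂ) = fun a => ⟪ξ, a η⟫_ℂ := by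
    funext a
    rw [tsum_eq_single 0 fun n hn => by simp [s, hn]]
    simp [s]
  rw [h2] at h1
  exact @Continuous.comp _ _ _ (_) (_) _ _ (fun a : K →L[ℂ] K => ⟪ξ, a η⟫_ℂ) h1
    continuous_induced_dom

/-- The restriction of a normal functional to a von Neumann subalgebra is normal. -/
theorem IsNormalFunctional.comp {M N : VonNeumannAlgebra K} {f : M.Elem → ℂ}
    (hf : IsNormalFunctional M f) (ι : N.Elem → M.Elem)
    (hι : ∀ a, (ι a : K →L[ℂ] K) = a) : IsNormalFunctional N fun a => f (ι a) := by
  refine @Continuous.comp _ _ _ (_) (_) _ _ _ hf ?_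
  refine continuous_induced_rng.2 ?_
  have h : M.incl ∘ ι = N.incl := funext hι
  rw [h]
  exact continuous_induced_dom

end Normal

/-! ### Compact subsystems -/

namespace WStarSystem

section Subsystem

variable {G : Type*} [Group G]
variable {K : Type*} [NormedAddCommGroup K] [InnerProductSpace ℂ K] [CompleteSpace K]
variable {L : Type*} [NormedAddCommGroup L] [InnerProductSpace ℂ L] [CompleteSpace L]
variable {F : WStarSystem G L} {A : WStarSystem G K} {ζ : F.alg.Elem →⋆ₐ[ℂ] A.alg.Elem}

theorem IsImbedding.totallyBounded_orbit_iff (J : F.H →ₗᵢ[ℂ] A.H)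
    (hJ : ∀ g x, J (F.unitary g x) = A.unitary g (J x)) (x : F.H) :
    TotallyBounded (Set.range fun g => F.unitary g x) ↔
      TotallyBounded (Set.range fun g => A.unitary g (J x)) := by
  rw [← totallyBounded_image_iff J.isometry.isUniformInducing, ← Set.range_comp]
  simp only [Function.comp_def, hJ]

theorem IsImbedding.isCompact (hζ : IsImbedding F A ζ)
    (h : ∀ a, (ζ a : K →L[ℂ] K) ∈ A.eigenAlgebra) : F.IsCompact := by
  obtain ⟨J, hJv, hJU⟩ := hζ.exists_isometry
  intro x
  rw [IsImbedding.totallyBounded_orbit_iff J hJU]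
  refine totallyBounded_orbit_of_mem_eigenvectorSpan A.unitaryHom ?_
  rw [← H0_eq]
  refine F.denseRange_vec.induction_on (p := fun x => J x ∈ A.H0) x
    (A.isClosed_H0.preimage J.continuous) fun a => ?_
  rw [hJv]
  exact (A.mem_eigenAlgebra_iff _).1 (h a)

theorem IsImbedding.eigenvalues_eq (hζ : IsImbedding F A ζ)
    (h : Set.range (fun a => (ζ a : K →L[ℂ] K)) = A.eigenAlgebra) :
    F.eigenvalues = A.eigenvalues := by
  obtain ⟨J, hJv, hJU⟩ := hζ.exists_isometry
  have hclosed : IsClosed (Set.range J) := J.isometry.isClosedEmbedding.isClosed_range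
  have hsub : (A.H0 : Set A.H) ⊆ Set.range J := by
    rw [← A.closure_vec_eigenAlgebra]
    refine closure_minimal ?_ hclosed
    rintro _ ⟨d, hd, rfl⟩
    obtain ⟨a, ha⟩ := h.ge hd
    rw [← A.alg.incl_injective ha, ← hJv]
    exact ⟨_, rfl⟩
  ext χ
  constructor
  · rintro ⟨x, hx0, hx⟩
    refine ⟨J x, (map_ne_zero_iff J J.injective).2 hx0, fun g => ?_⟩
    rw [← hJU, hx, map_smul]
  · rintro ⟨y, hy0, hy⟩
    obtain ⟨x, rfl⟩ := hsub (Submodule.le_topologicalClosure _ (Submodule.subset_span ⟨χ, hy0, hy⟩))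
    refine ⟨x, (map_ne_zero_iff J J.injective).1 hy0, fun g => J.injective ?_⟩
    rw [hJU, hy, map_smul]

theorem rep_action (A : WStarSystem G K) (g : G) (a : A.alg.Elem) :
    A.rep (A.action g a) = A.unitary g * A.rep a * star (A.unitary g) := by
  rw [A.star_unitary]
  ext x
  change _ = A.unitary g (A.rep a (A.unitary g⁻¹ x))
  rw [A.unitary_rep_apply, ← A.unitary_mul_apply, mul_inv_cancel, A.unitary_one_apply]

end Subsystem

/-- The GNS vectors of a compact subsystem have totally bounded orbits, hence lie in `H₀`. -/
theorem IsImbedding.mem_eigenAlgebra {G : Type*} [CommGroup G]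
    {K : Type*} [NormedAddCommGroup K] [InnerProductSpace ℂ K] [CompleteSpace K]
    {L : Type*} [NormedAddCommGroup L] [InnerProductSpace ℂ L] [CompleteSpace L]
    {F : WStarSystem G L} {A : WStarSystem G K} {ζ : F.alg.Elem →⋆ₐ[ℂ] A.alg.Elem}
    (hζ : IsImbedding F A ζ) (hF : F.IsCompact) (a : F.alg.Elem) :
    (ζ a : K →L[ℂ] K) ∈ A.eigenAlgebra := by
  obtain ⟨J, hJv, hJU⟩ := hζ.exists_isometry
  rw [mem_eigenAlgebra_iff, H0_eq, ← hJv]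
  exact mem_eigenvectorSpan_of_totallyBounded_orbit A.unitaryHom
    ((IsImbedding.totallyBounded_orbit_iff J hJU _).1 (hF _))

end WStarSystem

/-! ### The compact part of a system -/

theorem theorem5p4 {G : Type*} [CommGroup G]
    {K : Type*} [NormedAddCommGroup K] [InnerProductSpace ℂ K] [CompleteSpace K]
    (A : WStarSystem G K) :
    -- the systems `𝐀^K` and `𝐓`, and the maps: inclusion of `𝐀^K` into `𝐀`,
    -- `π_μ⁻¹` on `T` into `A`, `π_μ⁻¹` on `T` into `A^K`, and restriction of `T` to `H₀`
    ∃ (AK : WStarSystem G K) (ι : AK.alg.Elem →⋆ₐ[ℂ] A.alg.Elem)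
      (T : WStarSystem G A.H) (κ : T.alg.Elem →⋆ₐ[ℂ] A.alg.Elem) (ζ : T.alg.Elem →⋆ₐ[ℂ] AK.alg.Elem)
      (ρ : T.alg.Elem →⋆ₐ[ℂ] (A.H0 →L[ℂ] A.H0)) (ω : A.H0),
      -- `𝐀^K` is the subsystem of `𝐀`, by inclusion, generated by the eigenoperators
      AK.alg = A.eigenAlgebra ∧
      (∀ a : AK.alg.Elem, (ι a : K →L[ℂ] K) = a) ∧
      WStarSystem.IsImbedding AK A ι ∧
      -- `𝐓 = (T, ξ, τ)`
      (T.alg : Set (A.H →L[ℂ] A.H)) = A.compactPart ∧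
      (∀ a : T.alg.Elem, T.state a = ⟪A.cyclicVector, (a : A.H →L[ℂ] A.H) A.cyclicVector⟫_ℂ) ∧
      (∀ (g : G) (a : T.alg.Elem),
        (T.action g a : A.H →L[ℂ] A.H) = A.unitary g * a * star (A.unitary g)) ∧
      -- `𝐓` is a subsystem of `𝐀`, isomorphic to `𝐀^K`, through `π_μ⁻¹`
      (∀ a : T.alg.Elem, A.rep (κ a) = a) ∧
      WStarSystem.IsImbedding T A κ ∧
      (∀ a : T.alg.Elem, ι (ζ a) = κ a) ∧
      WStarSystem.IsIsomorphism T AK ζ ∧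
      -- `𝐀^K` is the largest compact subsystem of `𝐀`
      AK.IsCompact ∧
      (∀ (L : Type*) [NormedAddCommGroup L] [InnerProductSpace ℂ L] [CompleteSpace L]
        (F : WStarSystem G L) (η : F.alg.Elem →⋆ₐ[ℂ] A.alg.Elem),
        WStarSystem.IsImbedding F A η → F.IsCompact →
          ∀ a : F.alg.Elem, (η a : K →L[ℂ] K) ∈ AK.alg) ∧
      -- the closure of `T Ω_μ` is `H₀`, and `𝐓` is cyclically represented on `H₀`
      closure ((fun a : A.H →L[ℂ] A.H => a A.cyclicVector) '' A.compactPart) = A.H0 ∧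
      (ω : A.H) = A.cyclicVector ∧
      (∀ (a : T.alg.Elem) (x : A.H0), (ρ a x : A.H) = (a : A.H →L[ℂ] A.H) x) ∧
      T.IsCyclicRepresentation ρ ω ∧
      -- equality of the sets of eigenvalues
      T.eigenvalues = A.eigenvalues := by
  let M := A.eigenAlgebra
  have hMA : ∀ b : M.Elem, ∃ a : A.alg.Elem, A.alg.incl a = M.incl b := fun b =>
    ⟨⟨M.incl b, A.eigenAlgebra_le (Subtype.prop b)⟩, rfl⟩
  let ι : M.Elem →⋆ₐ[ℂ] A.alg.Elem :=
    StarAlgHom.liftOfInjective A.alg.incl A.alg.incl_injective M.incl hMA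
  have hι : ∀ b, A.alg.incl (ι b) = M.incl b :=
    StarAlgHom.liftOfInjective_spec A.alg.incl A.alg.incl_injective M.incl hMA
  have hιinj : Function.Injective ι := fun b c h =>
    M.incl_injective (by rw [← hι, ← hι, h])
  have hmem : ∀ b, A.alg.incl (ι b) ∈ A.eigenAlgebra := fun b => by
    rw [hι]
    exact Subtype.prop b
  have hsurj : ∀ d : A.alg.Elem, A.alg.incl d ∈ A.eigenAlgebra → ∃ b, ι b = d := fun d hd =>
    ⟨⟨_, hd⟩, A.alg.incl_injective (hι _)⟩
  have hιrange : (M : Set (K →L[ℂ] K)) = Set.range fun b => A.alg.incl (ι b) := by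
    simp only [hι]
    exact M.range_incl.symm
  obtain ⟨N, hN⟩ := A.exists_vonNeumannAlgebra_eq_rep_image M
  have hNA : ∀ b : N.Elem, ∃ a : A.alg.Elem, A.rep a = N.incl b := fun b => by
    obtain ⟨a, -, ha⟩ := hN.le (Subtype.prop b)
    exact ⟨a, ha⟩
  let κ : N.Elem →⋆ₐ[ℂ] A.alg.Elem :=
    StarAlgHom.liftOfInjective A.rep A.rep_injective N.incl hNA
  have hκ : ∀ b, A.rep (κ b) = N.incl b :=
    StarAlgHom.liftOfInjective_spec A.rep A.rep_injective N.incl hNA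
  have hκinj : Function.Injective κ := fun b c h =>
    N.incl_injective (by rw [← hκ, ← hκ, h])
  have hκmem : ∀ b, A.alg.incl (κ b) ∈ A.eigenAlgebra := fun b => by
    obtain ⟨a, ha, hab⟩ := hN.le (Subtype.prop b)
    rwa [← A.rep_injective (hab.trans (hκ b).symm)]
  have hκsurj : ∀ d : A.alg.Elem, A.alg.incl d ∈ A.eigenAlgebra → ∃ b, κ b = d := fun d hd =>
    ⟨⟨A.rep d, hN.ge ⟨d, hd, rfl⟩⟩, A.rep_injective (hκ _)⟩
  have hκrange : (M : Set (K →L[ℂ] K)) = Set.range fun b => A.alg.incl (κ b) := by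
    refine Set.Subset.antisymm (fun x hx => ?_) ?_
    · obtain ⟨b, hb⟩ := hκsurj ⟨x, A.eigenAlgebra_le hx⟩ hx
      exact ⟨b, congrArg A.alg.incl hb⟩
    · rintro _ ⟨b, rfl⟩
      exact hκmem b
  have hstate : ∀ b, A.state (κ b) = ⟪A.cyclicVector, N.incl b A.cyclicVector⟫_ℂ := fun b => by
    rw [← hκ, ← A.vec_one, A.rep_vec, A.inner_vec, star_one, one_mul, mul_one]
  have hιinv : ∀ g b, ∃ b', ι b' = A.action g (ι b) := fun g b =>
    hsurj _ (A.action_mem_eigenAlgebra g (hmem b))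
  have hκinv : ∀ g b, ∃ b', κ b' = A.action g (κ b) := fun g b =>
    hκsurj _ (A.action_mem_eigenAlgebra g (hκmem b))
  have hκnormal : IsNormalFunctional N fun b => A.state (κ b) := by
    simp only [hstate]
    exact isNormalFunctional_inner N _ _
  let AK := A.induced M ι hιinj hιinv (A.normal.comp ι hι)
  let T := A.induced N κ hκinj hκinv hκnormal
  have hAK : WStarSystem.IsImbedding AK A ι := A.induced_isImbedding M ι hιinj hιinv _ M hιrange
  have hT : WStarSystem.IsImbedding T A κ := A.induced_isImbedding N κ hκinj hκinv _ M hκrange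
  have hκι : ∀ b, ∃ c, ι c = κ b := fun b => hsurj _ (hκmem b)
  let ζ : N.Elem →⋆ₐ[ℂ] M.Elem := StarAlgHom.liftOfInjective ι hιinj κ hκι
  have hζ : ∀ b, ι (ζ b) = κ b := StarAlgHom.liftOfInjective_spec ι hιinj κ hκι
  have hζsurj : Function.Surjective ζ := fun c => by
    obtain ⟨b, hb⟩ := hκsurj _ (hmem c)
    exact ⟨b, hιinj (by rw [hζ, hb])⟩
  have hNH0 : ∀ a ∈ N, ∀ x ∈ A.H0, a x ∈ A.H0 := fun a ha x hx => by
    obtain ⟨d, hd, rfl⟩ := hN.le ha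
    exact A.rep_mem_H0 hd hx
  have hclosure : closure ((fun a : A.H →L[ℂ] A.H => a A.cyclicVector) '' A.compactPart) =
      A.H0 := by
    rw [A.compactPart_eq, Set.image_image]
    exact A.closure_vec_eigenAlgebra
  refine ⟨AK, ι, T, κ, ζ, N.restrictTo A.H0 hNH0, ⟨_, A.cyclicVector_mem_H0⟩, rfl, hι, hAK,
    hN.trans A.compactPart_eq.symm, hstate, fun g a => ?_, hκ, hT, hζ, ⟨⟨?_, ?_, ?_, ?_⟩, hζsurj⟩,
    hAK.isCompact hmem, fun L _ _ _ F η hη hF a => hη.mem_eigenAlgebra hF a, hclosure, rfl,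
    fun _ _ => rfl, ⟨fun a => (hstate a).symm, ?_⟩, hT.eigenvalues_eq hκrange.symm⟩
  · refine ((hκ _).symm.trans (congrArg A.rep (hT.action_eq g a).symm)).trans ?_
    exact (A.rep_action g (κ a)).trans
      (congrArg (fun t => A.unitary g * t * star (A.unitary g)) (hκ a))
  · exact fun b c h => hκinj ((hζ b).symm.trans ((congrArg ι h).trans (hζ c)))
  · refine ⟨M, M.range_incl.symm.trans ?_⟩
    exact (hζsurj.range_comp M.incl).symm
  · intro b
    exact congrArg A.state (hζ b)
  · intro g b
    refine hιinj ((hAK.action_eq g (ζ b)).symm.trans ?_)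
    exact (congrArg (A.action g) (hζ b)).trans ((hT.action_eq g b).trans (hζ _).symm)
  · intro x
    rw [Topology.IsInducing.subtypeVal.closure_eq_preimage_closure_image, Set.mem_preimage]
    refine closure_mono ?_ (hclosure.ge x.2)
    rintro _ ⟨a, ha, rfl⟩
    rw [A.compactPart_eq, ← hN] at ha
    exact ⟨_, ⟨⟨a, ha⟩, rfl⟩, rfl⟩
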